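/- **Setting.** Let $a_n>0$, $b_n\in\mathbb R$ ($n\ge 0$) satisfy, as $n\to\infty$, $$a_n=n^\sigma\big(1+\alpha n^{-1}+O(n^{-2})\big),\qquad b_n=2\gamma n^\sigma\big(1+\beta n^{-1}+O(n^{-2})\big),$$ with $\alpha,\beta\in\mathbb R$, $\gamma=\pm1$, $0<\sigma\le 3/2$, and put $\tau=2\beta-2\alpha+\sigma$. A sequence $F=(F_n)_{n\ge0}$ of complex numbers is a solution of the Jacobi equation at $z\in\mathbb C$ if $$a_{n-1}F_{n-1}+b_nF_n+a_nF_{n+1}=zF_n,\qquad n\ge 1.$$ The Wronskian of two solutions is $W[F,f]=a_n(F_nf_{n+1}-F_{n+1}f_n)$, which does not depend on $n$. The orthonormal polynomials $P_n(z)$ are given by the same recurrence for all $n\ge0$ with $P_{-1}=0$, $P_0=1$. Let $\sqrt{t}$, $t\in\mathbb C\setminus[0,\infty)$, be the branch with $\operatorname{Im}\sqrt t>0$. (For $t\ge0$ we take the non-positive root; below this affects only finitely many terms and is inessential.) Put $\rho=\sigma/2-1/4$ if $\sigma\ge1$, $\rho=\sigma/4$ if $\sigma\le 1$, and $t_n(w)=-\tau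 n^{-1}+wn^{-\sigma}$. If $\sigma\ge1$, let $T_n(w)=t_n(w)$. If $\sigma<1$, let $L$ be any integer with $(L+\tfrac12)\sigma>1$ and let $T_n(w)=t_n(w)+\sum_{l=2}^Lp_l\,t_n(w)^l$, where the real numbers $p_2,\dots,p_L$ are determined by the condition that the polynomial $p(t)=\sum_{l=2}^Lp_lt^l$ satisfies $$p(t)+\sum_{k=2}^{L}\frac{2(-1)^{k+1}}{(2k)!}\,\big(p(t)+t\big)^k=O(t^{L+1}),\qquad t\to0.$$ Put $\theta_n(w)=\sqrt{T_n(w)}$ and $\varphi_n(w)=\sum_{m=1}^n\theta_m(w)$. Finally let $$\varkappa(w)=\begin{cases}\pm\sqrt{|\tau|}&\sigma>1,\ \tau<0,\ \pm\operatorname{Im}w>0,\\ i\sqrt\tau&\sigma>1,\ \tau>0,\\ \sqrt w&\sigma<1,\\ \sqrt{w-\tau}&\sigma=1,\end{cases}$$ so that $\theta_n(w)=\varkappa(w)n^{-\nu}(1+o(1))$, where $\nu=\sigma-2\rho$. **Theorem.** Let one of the following conditions hold: 1. $1<\sigma\le3/2$ and either $\tau<0$, $\operatorname{Im}z\ne0$,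 or $\tau>0$, $z\in\mathbb C$ arbitrary; 2. $0<\sigma<1$ and $\gamma z\notin[0,\infty)$; 3. $\sigma=1$ and $\gamma z\notin[\tau,\infty)$. Then there is exactly one solution $f=(f_n(z))$ of the Jacobi equation (the Jost solution) such that, as $n\to\infty$, $$f_n(z)=(-\gamma)^nn^{-\rho}e^{i\varphi_n(\gamma z)}(1+o(1)).$$ Every solution $F=(F_n(z))$ of the Jacobi equation, in particular $F_n(z)=P_n(z)$, satisfies, as $n\to\infty$, $$F_n(z)=-i\,\frac{1}{2\varkappa(\gamma z)}\,(-\gamma)^{n+1}n^{-\rho}e^{-i\varphi_n(\gamma z)}\big(W[F,f]+o(1)\big);$$ if $W[F,f]\ne0$, this means that $$F_n(z)=-i\,W[F,f]\,\frac{1}{2\varkappa(\gamma z)}\,(-\gamma)^{n+1}n^{-\rho}e^{-i\varphi_n(\gamma z)}\big(1+o(1)\big).$$ -/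

import Mathlib

open Filter Asymptotics Polynomial

namespace CriticalJacobi

noncomputable section

/-- `F = (F 0, F 1, …)` solves the Jacobi equation
`a (n-1) F (n-1) + b n F n + a n F (n+1) = z F n` for all `n ≥ 1`. -/
def IsSolution (a b : ℕ → ℝ) (z : ℂ) (F : ℕ → ℂ) : Prop :=
  ∀ n : ℕ, (a n : ℂ) * F n + (b (n + 1) : ℂ) * F (n + 1) + (a (n + 1) : ℂ) * F (n + 2)
    = z * F (n + 1)

/-- The orthonormal polynomials `P n z` of the Jacobi coefficients `a`, `b`: the recurrence
`a (n-1) P (n-1) + b n P n + a n P (n+1) = z P n` for all `n ≥ 0`, with `P (-1) = 0`, `P 0 = 1`. -/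
def orthoPoly (a b : ℕ → ℝ) (z : ℂ) : ℕ → ℂ
  | 0 => 1
  | 1 => (z - (b 0 : ℂ)) / (a 0 : ℂ)
  | n + 2 => ((z - (b (n + 1) : ℂ)) * orthoPoly a b z (n + 1) - (a n : ℂ) * orthoPoly a b z n)
      / (a (n + 1) : ℂ)

theorem orthoPoly_isSolution {a : ℕ → ℝ} (ha : ∀ n, 0 < a n) (b : ℕ → ℝ) (z : ℂ) :
    IsSolution a b z (orthoPoly a b z) := by
  intro n
  have h : (a (n + 1) : ℂ) ≠ 0 := by exact_mod_cast (ha (n + 1)).ne'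
  rw [orthoPoly]
  field_simp
  ring

/-- The Wronskian `a n (F n f (n+1) - F (n+1) f n)`, evaluated at `n = 0`; on pairs of solutions
it does not depend on `n`, see `wronskian_eq`. -/
def wronskian (a : ℕ → ℝ) (F f : ℕ → ℂ) : ℂ :=
  (a 0 : ℂ) * (F 0 * f 1 - F 1 * f 0)

theorem wronskian_eq {a b : ℕ → ℝ} {z : ℂ} {F f : ℕ → ℂ} (hF : IsSolution a b z F)
    (hf : IsSolution a b z f) (n : ℕ) :
    wronskian a F f = (a n : ℂ) * (F n * f (n + 1) - F (n + 1) * f n) := by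
  induction n with
  | zero => rfl
  | succ n ih =>
    rw [ih]
    linear_combination f (n + 1) * hF n - F (n + 1) * hf n

/-- The branch of the square root on `ℂ \ [0, ∞)` with positive imaginary part. -/
def upperSqrt (t : ℂ) : ℂ := Complex.I * Complex.sqrt (-t)

theorem upperSqrt_sq (t : ℂ) : upperSqrt t ^ 2 = t := by
  have h : (Complex.sqrt (-t)) ^ 2 = -t := by
    rw [Complex.sqrt, ← Complex.cpow_nat_mul]
    simp
  rw [upperSqrt, mul_pow, Complex.I_sq, h]
  ring

theorem upperSqrt_im_pos {t : ℂ} (ht : ∀ x : ℝ, 0 ≤ x → t ≠ (x : ℂ)) :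
    0 < (upperSqrt t).im := by
  have h1 : (upperSqrt t).im = Real.sqrt ((‖t‖ - t.re) / 2) := by
    simp [upperSqrt, Complex.sqrt, Complex.cpow_inv_two_re, sub_eq_add_neg]
  rw [h1]
  apply Real.sqrt_pos.2
  have h2 : t.re < ‖t‖ := by
    refine lt_of_le_of_ne (Complex.re_le_norm t) fun h => ?_
    have h3 : 0 ≤ t.re := h ▸ norm_nonneg t
    refine ht t.re h3 ?_
    exact (Complex.re_eq_norm.1 h |> Complex.eq_re_of_ofReal_le)
  linarith

/-- The exponent `ρ` of the amplitude. -/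
def rho (σ : ℝ) : ℝ := if 1 ≤ σ then σ / 2 - 1 / 4 else σ / 4

/-- `t_n(w) = -τ / n + w n ^ (-σ)`. -/
def tSeq (σ τ : ℝ) (w : ℂ) (n : ℕ) : ℂ :=
  -(τ : ℂ) / (n : ℂ) + w * (((n : ℝ) ^ (-σ) : ℝ) : ℂ)

/-- The numbers `2 (-1) ^ (k + 1) / (2 k)!`, the Taylor coefficients of `2 - 2 cos θ` in powers
of `θ ^ 2`. -/
def cosCoeff (k : ℕ) : ℝ := 2 * (-1) ^ (k + 1) / ((2 * k).factorial : ℝ)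

/-- The polynomials `P_L(t) = ∑_{l=2}^L p_l t ^ l` with
`P_L(t) + ∑_{k=2}^L cosCoeff k * (P_L(t) + t) ^ k = O(t ^ (L + 1))` as `t → 0`; the coefficient
`p_{L+1}` is chosen so as to cancel the power `t ^ (L + 1)`, see `eikonalPoly_spec`. -/
def eikonalPoly : ℕ → ℝ[X]
  | 0 => 0
  | L + 1 => eikonalPoly L - C ((eikonalPoly L +
      ∑ k ∈ Finset.Icc 2 (L + 1), C (cosCoeff k) * (eikonalPoly L + X) ^ k).coeff (L + 1))
        * X ^ (L + 1)

/-- `P_L` has only the powers `2, …, L`, and it solves the eikonal equation up to order `L`. -/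
theorem eikonalPoly_spec (L : ℕ) :
    (X : ℝ[X]) ^ 2 ∣ eikonalPoly L ∧ (eikonalPoly L).natDegree ≤ L ∧
    (X : ℝ[X]) ^ (L + 1) ∣
      eikonalPoly L + ∑ k ∈ Finset.Icc 2 L, C (cosCoeff k) * (eikonalPoly L + X) ^ k := by
  induction L with
  | zero => simp [eikonalPoly]
  | succ n ih =>
    rcases Nat.eq_zero_or_pos n with rfl | hn
    · simp [eikonalPoly]
    obtain ⟨h2, hd, hq⟩ := ih
    have hS : eikonalPoly (n + 1) = eikonalPoly n - C ((eikonalPoly n +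
      ∑ k ∈ Finset.Icc 2 (n + 1), C (cosCoeff k) * (eikonalPoly n + X) ^ k).coeff (n + 1))
        * X ^ (n + 1) := by rw [eikonalPoly]
    generalize hR : eikonalPoly n +
      ∑ k ∈ Finset.Icc 2 (n + 1), C (cosCoeff k) * (eikonalPoly n + X) ^ k = R at hS
    generalize eikonalPoly (n + 1) = Q at hS ⊢
    generalize eikonalPoly n = P at hS hR h2 hd hq
    have hXP : X ∣ P + X := dvd_add ((dvd_pow_self X two_ne_zero).trans h2) dvd_rfl
    have hm : (X : ℝ[X]) ^ (n + 1) ∣ Q - P :=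
      ⟨-C (R.coeff (n + 1)), by rw [hS]; ring⟩
    have hXQ : X ∣ Q + X := by
      have h : Q + X = (P + X) + (Q - P) := by ring
      rw [h]
      exact dvd_add hXP ((dvd_pow_self X n.succ_ne_zero).trans hm)
    have hRX : (X : ℝ[X]) ^ (n + 1) ∣ R := by
      rw [← hR, Finset.sum_Icc_succ_top (by omega), ← add_assoc]
      exact dvd_add hq ((pow_dvd_pow_of_dvd hXP _).mul_left _)
    refine ⟨?_, ?_, ?_⟩
    · have h : Q = P + (Q - P) := by ring
      rw [h]
      exact dvd_add h2 ((pow_dvd_pow X (by omega)).trans hm)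
    · rw [hS]
      exact (natDegree_sub_le _ _).trans
        (max_le (hd.trans n.le_succ) (natDegree_C_mul_X_pow_le _ _))
    · have hk : ∀ k ∈ Finset.Icc 2 (n + 1), (X : ℝ[X]) ^ (n + 1 + 1) ∣
          C (cosCoeff k) * (Q + X) ^ k - C (cosCoeff k) * (P + X) ^ k := by
        intro k hk
        have hk2 : 2 ≤ k := (Finset.mem_Icc.1 hk).1
        rw [← mul_sub]
        refine Dvd.dvd.mul_left ?_ _
        rw [← (Commute.all (Q + X) (P + X)).geom_sum₂_mul k, mul_comm, pow_succ]
        refine mul_dvd_mul (by simpa using hm) (Finset.dvd_sum fun i hi => ?_)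
        rcases Nat.eq_zero_or_pos i with rfl | hi0
        · exact (dvd_pow hXP (by omega)).mul_left _
        · exact (dvd_pow hXQ (by omega)).mul_right _
      have hsum := Finset.dvd_sum hk
      rw [Finset.sum_sub_distrib] at hsum
      have hlast : (X : ℝ[X]) ^ (n + 1 + 1) ∣ R - C (R.coeff (n + 1)) * X ^ (n + 1) := by
        rw [X_pow_dvd_iff] at hRX ⊢
        intro d hd'
        rw [coeff_sub, coeff_C_mul, coeff_X_pow]
        rcases Nat.lt_succ_iff_lt_or_eq.1 hd' with h | rfl
        · simp [hRX d h, h.ne]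
        · simp
      have h := dvd_add hsum hlast
      convert h using 1
      rw [← hR] at hS ⊢
      rw [hS]
      ring

/-- `T_n(w)`: it is `t_n(w)` for `σ ≥ 1` and `t_n(w) + ∑_{l=2}^L p_l t_n(w) ^ l` for `σ < 1`. -/
def TSeq (σ τ : ℝ) (L : ℕ) (w : ℂ) (n : ℕ) : ℂ :=
  if σ < 1 then tSeq σ τ w n + aeval (tSeq σ τ w n) (eikonalPoly L) else tSeq σ τ w n

/-- `θ_n(w) = √(T_n(w))`. -/
def theta (σ τ : ℝ) (L : ℕ) (w : ℂ) (n : ℕ) : ℂ := upperSqrt (TSeq σ τ L w n)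

/-- The phases `φ_n(w) = θ_1(w) + ⋯ + θ_n(w)`. -/
def phi (σ τ : ℝ) (L : ℕ) (w : ℂ) (n : ℕ) : ℂ := ∑ m ∈ Finset.Icc 1 n, theta σ τ L w m

/-- The leading coefficient `ϰ(w)` of the phases: `θ_n(w) ∼ ϰ(w) n ^ (-ν)` with `ν = 1/2` for
`σ ≥ 1` and `ν = σ/2` for `σ ≤ 1`. -/
def kappa (σ τ : ℝ) (w : ℂ) : ℂ :=
  if 1 < σ then
    if τ < 0 then
      if 0 ≤ w.im then (Real.sqrt |τ| : ℂ) else -(Real.sqrt |τ| : ℂ)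
    else Complex.I * (Real.sqrt τ : ℂ)
  else if σ < 1 then upperSqrt w
  else upperSqrt (w - (τ : ℂ))

/-- The decaying Ansatz `(-γ) ^ n n ^ (-ρ) exp (i φ_n(γ z))`. -/
def decayingAnsatz (σ τ γ : ℝ) (L : ℕ) (z : ℂ) (n : ℕ) : ℂ :=
  (-(γ : ℂ)) ^ n * (((n : ℝ) ^ (-rho σ) : ℝ) : ℂ)
    * Complex.exp (Complex.I * phi σ τ L ((γ : ℂ) * z) n)

/-- The growing Ansatz `(-γ) ^ (n + 1) n ^ (-ρ) exp (-i φ_n(γ z))`. -/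
def growingAnsatz (σ τ γ : ℝ) (L : ℕ) (z : ℂ) (n : ℕ) : ℂ :=
  (-(γ : ℂ)) ^ (n + 1) * (((n : ℝ) ^ (-rho σ) : ℝ) : ℂ)
    * Complex.exp (-(Complex.I * phi σ τ L ((γ : ℂ) * z) n))

/-- `f` is the Jost solution at the point `z`: it solves the Jacobi equation and
`f n = (-γ) ^ n n ^ (-ρ) exp (i φ_n(γ z)) (1 + o(1))` as `n → ∞`. -/
def IsJostSolution (a b : ℕ → ℝ) (σ τ γ : ℝ) (L : ℕ) (z : ℂ) (f : ℕ → ℂ) : Prop :=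
  IsSolution a b z f ∧ f ~[atTop] decayingAnsatz σ τ γ L z

/-- `F n = -i W[F, f] (2 ϰ(γ z))⁻¹ (-γ) ^ (n + 1) n ^ (-ρ) exp (-i φ_n(γ z)) (1 + o(1))` as
`n → ∞` if `W[F, f] ≠ 0`; in any case `W[F, f] (1 + o(1))` may be replaced by `W[F, f] + o(1)`. -/
def HasRegularAsymptotics (a : ℕ → ℝ) (σ τ γ : ℝ) (L : ℕ) (z : ℂ) (f F : ℕ → ℂ) : Prop :=
  (fun n => F n - -Complex.I * wronskian a F f * (2 * kappa σ τ ((γ : ℂ) * z))⁻¹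
      * growingAnsatz σ τ γ L z n) =o[atTop] growingAnsatz σ τ γ L z ∧
  (wronskian a F f ≠ 0 →
    F ~[atTop] fun n => -Complex.I * wronskian a F f * (2 * kappa σ τ ((γ : ℂ) * z))⁻¹
      * growingAnsatz σ τ γ L z n)

/-- The regular points `z`, in each of the three regimes of `σ`; for `σ > 1` this includes the
assumption `τ ≠ 0`. -/
def IsRegularPoint (σ τ γ : ℝ) (z : ℂ) : Prop :=
  (1 < σ ∧ σ ≤ 3 / 2 ∧ ((τ < 0 ∧ z.im ≠ 0) ∨ 0 < τ)) ∨
  (0 < σ ∧ σ < 1 ∧ ∀ x : ℝ, 0 ≤ x → z ≠ ((γ * x : ℝ) : ℂ)) ∨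
  (σ = 1 ∧ ∀ x : ℝ, τ ≤ x → z ≠ ((γ * x : ℝ) : ℂ))

end

end CriticalJacobi

/-!
The proof compares the Jacobi equation with two explicit approximate solutions, the decaying Ansatz
`P n = (-γ) ^ n n ^ (-ρ) exp (i φ_n)` and the growing one
`M n = (-γ) ^ (n + 1) n ^ (-ρ) exp (-i φ_n)`.

*The residuals are small.* Inserted into the Jacobi equation and multiplied by the respective other
Ansatz, both leave the same expression `phaseResidual`, up to the sign of the phase. With
`ν = min σ 1 / 2` and `t_n = -τ / n + γ z n ^ (-σ)` it equals `n ^ ν` times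
`t_n - (2 - 2 cos θ_n) + i (θ_{n+1} - θ_n + ν θ_n / n)`, up to negligible terms. The first difference
is small because `θ_n` solves the eikonal equation approximately (`eikonal_of_sq_eq`, where the
polynomial `P_L` enters), the second because `θ_n` is close to a multiple of `n ^ (-ν)`
(`IsPhase.succ_sub`). The result, `IsPhase.phaseResidual`, is that the weighted residuals are
summable.

*The Ansätze are well separated.* The imaginary parts of the `θ_n` are nonnegative and eventually
bounded from below by a multiple of `1 / n` (`theta_leading`). Hence `|P n / M n| = exp (-2 Im φ_n)`
decreases to zero. The expression `a n (M n P (n+1) - M (n+1) P n)` tends to `2 i ϰ ≠ 0`.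

*From approximate to true solutions.* Writing a solution as `F n = (α n P n + β n M n) / w n`, where
`α`, `β`, `w` are the Casoratians of the pairs `(M, F)`, `(F, P)`, `(M, P)`, the increments of `α`
and `β` are products of `F` with the residuals. This is a discrete Levinson system with an ordinary
dichotomy (`NearlyConstant`), in which `β` converges for every solution and `α P / M` tends to zero.
The limit of `β` is a linear functional on the two-dimensional space of solutions, so it vanishes on
some nontrivial solution; for such a solution `α` has a nonzero limit and `β M / P` tends to zero
(`NearlyConstant.recessive`), and a multiple of it is the Jost solution. Finally
`w n W[F, f] = β_F α_f - α_F β_f` identifies the limit of `β_F` with the Wronskian, which gives the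
asymptotics of all solutions, and uniqueness of `f` follows from them.
-/

namespace CriticalJacobi

open scoped Topology

/-! ### Nearly constant pairs of coefficients -/

/-- The data of a discrete Levinson theorem: an ordinary dichotomy `D`, that is, a sequence that
decreases to zero at a bounded rate, and a small summable perturbation `ε`. -/
structure Dichotomy (D ε : ℕ → ℝ) : Prop where
  pos : ∀ n, 0 < D n
  anti : Antitone D
  le_two_mul : ∀ n, D n ≤ 2 * D (n + 1)
  tendsto : Tendsto D atTop (𝓝 0)
  nonneg : ∀ n, 0 ≤ ε n
  summable : Summable ε
  tsum_le : ∑' n, ε n ≤ 1 / 8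

/-- The coefficients `α n`, `β n` of a solution `α n * P n + β n * M n`, where the quotient
`P n / M n` has size `D n`, vary slowly: their increments, weighted according to the size of `P` and
`M`, are controlled by `ε n`. -/
structure NearlyConstant (D ε : ℕ → ℝ) (α β : ℕ → ℂ) : Prop where
  left : ∀ n, D (n + 1) * ‖α (n + 1) - α n‖ ≤ ε n * (D (n + 1) * ‖α n‖ + ‖β n‖)
  right : ∀ n, ‖β (n + 1) - β n‖ ≤ ε n * (D (n + 1) * ‖α n‖ + ‖β n‖)

section Levinson

variable {D ε : ℕ → ℝ} {α β : ℕ → ℂ}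

theorem Dichotomy.sum_Ico_le_tail (h : Dichotomy D ε) (k n : ℕ) :
    ∑ i ∈ Finset.Ico k n, ε i ≤ ∑' i, ε (i + k) := by
  rw [Finset.sum_Ico_eq_sum_range]
  simp_rw [add_comm k]
  exact ((summable_nat_add_iff k).2 h.summable).sum_le_tsum _ fun i _ => h.nonneg _

theorem Dichotomy.sum_Ico_le (h : Dichotomy D ε) (k n : ℕ) :
    ∑ i ∈ Finset.Ico k n, ε i ≤ 1 / 8 :=
  (h.summable.sum_le_tsum _ fun _ _ => h.nonneg _).trans h.tsum_le

/-- The total size of the pair at most doubles after any given index. -/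
theorem NearlyConstant.size_le (h : Dichotomy D ε) (hc : NearlyConstant D ε α β) {k n : ℕ}
    (hkn : k ≤ n) : D n * ‖α n‖ + ‖β n‖ ≤ 2 * (D k * ‖α k‖ + ‖β k‖) := by
  set s := D k * ‖α k‖ + ‖β k‖ with hs
  have hs0 : 0 ≤ s := by have := (h.pos k).le; positivity
  have key : D n * ‖α n‖ + ‖β n‖ ≤ s + 4 * s * ∑ i ∈ Finset.Ico k n, ε i := by
    induction n, hkn using Nat.le_induction with
    | base => simp [hs]
    | succ n hn ih =>
      rw [Finset.sum_Ico_succ_top hn]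
      have hb : D n * ‖α n‖ + ‖β n‖ ≤ 2 * s := by nlinarith [h.sum_Ico_le k n]
      have hD : D (n + 1) * ‖α n‖ ≤ D n * ‖α n‖ :=
        mul_le_mul_of_nonneg_right (h.anti n.le_succ) (norm_nonneg _)
      have hm : ε n * (D (n + 1) * ‖α n‖ + ‖β n‖) ≤ ε n * (2 * s) :=
        mul_le_mul_of_nonneg_left (by linarith) (h.nonneg n)
      have h1 : D (n + 1) * ‖α (n + 1)‖ ≤ D (n + 1) * ‖α n‖ + D (n + 1) * ‖α (n + 1) - α n‖ := by
        rw [← mul_add]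
        exact mul_le_mul_of_nonneg_left (norm_le_norm_add_norm_sub' _ _) (h.pos _).le
      have h2 : ‖β (n + 1)‖ ≤ ‖β n‖ + ‖β (n + 1) - β n‖ := norm_le_norm_add_norm_sub' _ _
      linarith [hc.left n, hc.right n]
  nlinarith [h.sum_Ico_le k n]

theorem NearlyConstant.increment_le (h : Dichotomy D ε) (hc : NearlyConstant D ε α β) {k n : ℕ}
    (hkn : k ≤ n) :
    ε n * (D (n + 1) * ‖α n‖ + ‖β n‖) ≤ 2 * (D k * ‖α k‖ + ‖β k‖) * ε n := by
  rw [mul_comm _ (ε n)]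
  refine mul_le_mul_of_nonneg_left ?_ (h.nonneg n)
  refine le_trans ?_ (hc.size_le h hkn)
  gcongr
  exact h.anti n.le_succ

theorem NearlyConstant.norm_sub_le (h : Dichotomy D ε) (hc : NearlyConstant D ε α β) {k n : ℕ}
    (hkn : k ≤ n) : ‖β n - β k‖ ≤ (D k * ‖α k‖ + ‖β k‖) / 4 := by
  have h1 := dist_le_Ico_sum_of_dist_le (f := β) (d := fun i => 2 * (D k * ‖α k‖ + ‖β k‖) * ε i)
    hkn (fun {j} hj _ => by
      rw [dist_comm, dist_eq_norm]
      exact (hc.right j).trans (hc.increment_le h hj))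
  rw [dist_comm, dist_eq_norm, ← Finset.mul_sum] at h1
  have := (h.pos k).le
  have hs : 0 ≤ D k * ‖α k‖ + ‖β k‖ := by positivity
  nlinarith [h.sum_Ico_le k n]

/-- The coefficient of the dominant solution converges. -/
theorem NearlyConstant.exists_tendsto_right (h : Dichotomy D ε) (hc : NearlyConstant D ε α β) :
    ∃ l, Tendsto β atTop (𝓝 l) := by
  refine cauchySeq_tendsto_of_complete (cauchySeq_of_dist_le_of_summable
    (fun i => 2 * (D 0 * ‖α 0‖ + ‖β 0‖) * ε i) (fun n => ?_) (h.summable.mul_left _))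
  rw [dist_comm, dist_eq_norm]
  exact (hc.right n).trans (hc.increment_le h n.zero_le)

/-- The recessive part of the solution is negligible compared with the dominant one. -/
theorem NearlyConstant.tendsto_mul_left (h : Dichotomy D ε) (hc : NearlyConstant D ε α β) :
    Tendsto (fun n => D n * ‖α n‖) atTop (𝓝 0) := by
  set s := D 0 * ‖α 0‖ + ‖β 0‖ with hs
  have hs0 : 0 ≤ s := by have := (h.pos 0).le; positivity
  have key : ∀ k n, k ≤ n → D n * ‖α n‖ ≤ D n * ‖α k‖ + 2 * s * ∑ i ∈ Finset.Ico k n, ε i := by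
    intro k n hkn
    induction n, hkn using Nat.le_induction with
    | base => simp
    | succ n hn ih =>
      rw [Finset.sum_Ico_succ_top hn]
      have h1 : ‖α n‖ ≤ ‖α k‖ + 2 * s * (∑ i ∈ Finset.Ico k n, ε i) / D n := by
        have hp := h.pos n
        rw [← mul_le_mul_iff_right₀ hp]
        rw [mul_add, mul_div_cancel₀ _ hp.ne']
        exact ih
      have hS : 0 ≤ ∑ i ∈ Finset.Ico k n, ε i := Finset.sum_nonneg fun i _ => h.nonneg i
      have h2 : D (n + 1) * (2 * s * (∑ i ∈ Finset.Ico k n, ε i) / D n)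
          ≤ 2 * s * ∑ i ∈ Finset.Ico k n, ε i := by
        rw [mul_div_assoc', div_le_iff₀ (h.pos n), mul_comm]
        exact mul_le_mul_of_nonneg_left (h.anti n.le_succ) (by positivity)
      have h3 : D (n + 1) * ‖α (n + 1)‖ ≤ D (n + 1) * ‖α n‖ + D (n + 1) * ‖α (n + 1) - α n‖ := by
        rw [← mul_add]
        exact mul_le_mul_of_nonneg_left (norm_le_norm_add_norm_sub' _ _) (h.pos _).le
      have h4 := (hc.left n).trans (hc.increment_le h n.zero_le)
      have h5 := mul_le_mul_of_nonneg_left h1 (h.pos (n + 1)).le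
      linarith
  rw [Metric.tendsto_atTop]
  intro e he
  have ht := ((tendsto_sum_nat_add ε).const_mul (2 * s)).eventually_lt_const
    (show 2 * s * 0 < e / 2 by linarith)
  obtain ⟨k, hk⟩ := ht.exists
  have hD := (h.tendsto.mul_const ‖α k‖).eventually_lt_const (show 0 * ‖α k‖ < e / 2 by linarith)
  obtain ⟨N, hN⟩ := eventually_atTop.1 hD
  refine ⟨max k N, fun n hn => ?_⟩
  have hp : 0 ≤ D n * ‖α n‖ := by have := (h.pos n).le; positivity
  rw [Real.dist_eq, sub_zero, abs_of_nonneg hp]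
  have h1 := key k n (le_of_max_le_left hn)
  have h2 := hN n (le_of_max_le_right hn)
  have h3 := mul_le_mul_of_nonneg_left (h.sum_Ico_le_tail k n) (show 0 ≤ 2 * s by linarith)
  linarith

/-- If the dominant coefficient tends to zero, then the recessive part prevails at every index:
otherwise the dominant coefficient could not change by more than half its size afterwards. -/
theorem NearlyConstant.norm_right_le (h : Dichotomy D ε) (hc : NearlyConstant D ε α β)
    (hβ : Tendsto β atTop (𝓝 0)) (k : ℕ) : ‖β k‖ ≤ D k * ‖α k‖ := by
  by_contra! hk
  have hb : 0 < ‖β k‖ := lt_of_le_of_lt (by have := (h.pos k).le; positivity) hk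
  have hlow : ∀ᶠ n in atTop, ‖β k‖ / 2 ≤ ‖β n‖ := by
    filter_upwards [eventually_ge_atTop k] with n hn
    have h1 := hc.norm_sub_le h hn
    have h2 := norm_le_norm_add_norm_sub (β n) (β k)
    linarith
  have := ge_of_tendsto hβ.norm hlow
  rw [norm_zero] at this
  linarith

/-- If the dominant coefficient of a nontrivial pair tends to zero, then the recessive coefficient
has a nonzero limit, and the dominant part is negligible compared with the recessive one. -/
theorem NearlyConstant.recessive (h : Dichotomy D ε) (hc : NearlyConstant D ε α β)
    (hβ : Tendsto β atTop (𝓝 0)) (hne : α 0 ≠ 0 ∨ β 0 ≠ 0) :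
    (∃ l, l ≠ 0 ∧ Tendsto α atTop (𝓝 l)) ∧ Tendsto (fun n => ‖β n‖ / D n) atTop (𝓝 0) := by
  have hle := hc.norm_right_le h hβ
  have hα0 : 0 < ‖α 0‖ := by
    rcases hne with h0 | h0
    · exact norm_pos_iff.2 h0
    · exact pos_of_mul_pos_right ((norm_pos_iff.2 h0).trans_le (hle 0)) (h.pos 0).le
  have hstep : ∀ n, ‖α (n + 1) - α n‖ ≤ 3 * ‖α n‖ * ε n := by
    intro n
    rw [← mul_le_mul_iff_right₀ (h.pos (n + 1))]
    refine (hc.left n).trans ?_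
    have h1 := (hle n).trans (mul_le_mul_of_nonneg_right (h.le_two_mul n) (norm_nonneg (α n)))
    calc ε n * (D (n + 1) * ‖α n‖ + ‖β n‖)
        ≤ ε n * (D (n + 1) * ‖α n‖ + 2 * D (n + 1) * ‖α n‖) :=
          mul_le_mul_of_nonneg_left (by linarith) (h.nonneg n)
      _ = _ := by ring
  have hdist : ∀ n, ‖α n - α 0‖ ≤ 6 * ‖α 0‖ * ∑ i ∈ Finset.Ico 0 n, ε i := by
    intro n
    induction n with
    | zero => simp
    | succ n ih =>
      rw [Finset.sum_Ico_succ_top n.zero_le]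
      have h1 : ‖α n‖ ≤ 2 * ‖α 0‖ := by
        have := norm_le_norm_add_norm_sub' (α n) (α 0)
        nlinarith [h.sum_Ico_le 0 n]
      have h2 := norm_sub_le_norm_sub_add_norm_sub (α (n + 1)) (α n) (α 0)
      have h3 := mul_le_mul_of_nonneg_right h1 (h.nonneg n)
      linarith [hstep n]
  have hdist' : ∀ n, ‖α n - α 0‖ ≤ 3 / 4 * ‖α 0‖ := fun n =>
    (hdist n).trans (by nlinarith [h.sum_Ico_le 0 n])
  have hbd : ∀ n, ‖α n‖ ≤ 2 * ‖α 0‖ := fun n => by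
    have := norm_le_norm_add_norm_sub' (α n) (α 0)
    linarith [hdist' n]
  constructor
  · obtain ⟨l, hl⟩ := cauchySeq_tendsto_of_complete (cauchySeq_of_dist_le_of_summable
      (f := α) (fun i => 6 * ‖α 0‖ * ε i) (fun n => by
        rw [dist_comm, dist_eq_norm]
        refine (hstep n).trans (mul_le_mul_of_nonneg_right ?_ (h.nonneg n))
        linarith [hbd n]) (h.summable.mul_left _))
    refine ⟨l, fun h0 => ?_, hl⟩
    have h1 := le_of_tendsto ((hl.sub_const (α 0)).norm) (Eventually.of_forall hdist')
    rw [h0, zero_sub, norm_neg] at h1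
    linarith
  · have hb : ∀ n, ‖β n‖ / D n ≤ 4 * ‖α 0‖ * ∑' i, ε (i + n) := by
      intro n
      rw [div_le_iff₀ (h.pos n)]
      have hm : ∀ m ≥ n, ‖β m - β n‖ ≤ 4 * ‖α 0‖ * (∑' i, ε (i + n)) * D n := by
        intro m hm
        have h1 := dist_le_Ico_sum_of_dist_le (f := β) (d := fun i => 4 * ‖α 0‖ * D n * ε i)
          hm (fun {j} hj _ => by
            rw [dist_comm, dist_eq_norm]
            refine (hc.right j).trans ?_
            rw [mul_comm _ (ε j)]
            refine mul_le_mul_of_nonneg_left ?_ (h.nonneg j)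
            have e1 : D (j + 1) * ‖α j‖ ≤ D n * (2 * ‖α 0‖) :=
              mul_le_mul (h.anti (hj.trans j.le_succ)) (hbd j) (norm_nonneg _) (h.pos n).le
            have e2 : D j * ‖α j‖ ≤ D n * (2 * ‖α 0‖) :=
              mul_le_mul (h.anti hj) (hbd j) (norm_nonneg _) (h.pos n).le
            linarith [hle j])
        rw [dist_comm, dist_eq_norm, ← Finset.mul_sum] at h1
        have := (h.pos n).le
        have h2 := mul_le_mul_of_nonneg_left (h.sum_Ico_le_tail n m)
          (show 0 ≤ 4 * ‖α 0‖ * D n by positivity)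
        linarith
      have h1 := le_of_tendsto ((hβ.sub_const (β n)).norm) (eventually_atTop.2 ⟨n, hm⟩)
      rwa [zero_sub, norm_neg] at h1
    refine squeeze_zero (fun n => by have := (h.pos n).le; positivity) hb ?_
    simpa using (tendsto_sum_nat_add ε).const_mul (4 * ‖α 0‖)

end Levinson

/-! ### Solutions of the Jacobi equation and approximate solutions -/

/-- The expression `a n (u n v (n+1) - u (n+1) v n)` for arbitrary sequences `u`, `v`; on pairs of
solutions it is the constant `wronskian a u v`. -/
def casoratian (a : ℕ → ℝ) (u v : ℕ → ℂ) (n : ℕ) : ℂ :=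
  (a n : ℂ) * (u n * v (n + 1) - u (n + 1) * v n)

/-- The amount by which `P` fails to satisfy the Jacobi equation with the number `n + 1`. -/
def residual (a b : ℕ → ℝ) (z : ℂ) (P : ℕ → ℂ) (n : ℕ) : ℂ :=
  (a n : ℂ) * P n + ((b (n + 1) : ℂ) - z) * P (n + 1) + (a (n + 1) : ℂ) * P (n + 2)

/-- The solution of the Jacobi equation with given values at `0` and `1`. -/
noncomputable def solutionOf (a b : ℕ → ℝ) (z x y : ℂ) : ℕ → ℂ
  | 0 => x
  | 1 => y
  | n + 2 => ((z - (b (n + 1) : ℂ)) * solutionOf a b z x y (n + 1)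
      - (a n : ℂ) * solutionOf a b z x y n) / (a (n + 1) : ℂ)

section Solutions

variable {a b : ℕ → ℝ} {z : ℂ} {F f P M : ℕ → ℂ}

theorem solutionOf_isSolution (ha : ∀ n, 0 < a n) (b : ℕ → ℝ) (z x y : ℂ) :
    IsSolution a b z (solutionOf a b z x y) := by
  intro n
  have h : (a (n + 1) : ℂ) ≠ 0 := by exact_mod_cast (ha (n + 1)).ne'
  rw [solutionOf]
  field_simp
  ring

theorem IsSolution.linear_comb (hF : IsSolution a b z F) (hf : IsSolution a b z f) (c d : ℂ) :
    IsSolution a b z fun n => c * F n + d * f n := fun n => by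
  linear_combination c * hF n + d * hf n

theorem IsSolution.eq_zero (ha : ∀ n, 0 < a n) (hF : IsSolution a b z F) {N : ℕ}
    (h0 : F N = 0) (h1 : F (N + 1) = 0) : F = 0 := by
  have ha' : ∀ n, (a n : ℂ) ≠ 0 := fun n => by exact_mod_cast (ha n).ne'
  have hdown : F 0 = 0 ∧ F 1 = 0 := by
    induction N with
    | zero => exact ⟨h0, h1⟩
    | succ N ih =>
      refine ih ?_ h0
      have := hF N
      rw [h0, h1] at this
      simpa [ha' N] using this
  have hup : ∀ n, F n = 0 ∧ F (n + 1) = 0 := by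
    intro n
    induction n with
    | zero => exact hdown
    | succ n ih =>
      refine ⟨ih.2, ?_⟩
      have := hF n
      rw [ih.1, ih.2] at this
      simpa [ha' (n + 1)] using this
  exact funext fun n => (hup n).1

theorem casoratian_mul_eq (n : ℕ) :
    casoratian a M P n * F n = casoratian a M F n * P n + casoratian a F P n * M n := by
  simp only [casoratian]; ring

theorem casoratian_mul_eq_succ (n : ℕ) :
    casoratian a M P n * F (n + 1)
      = casoratian a M F n * P (n + 1) + casoratian a F P n * M (n + 1) := by
  simp only [casoratian]; ring

theorem casoratian_mul_wronskian (hF : IsSolution a b z F) (hf : IsSolution a b z f) (n : ℕ) :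
    casoratian a M P n * wronskian a F f
      = casoratian a F P n * casoratian a M f n - casoratian a M F n * casoratian a f P n := by
  rw [wronskian_eq hF hf n]
  simp only [casoratian]; ring

theorem IsSolution.casoratian_right_succ_sub (hF : IsSolution a b z F) (n : ℕ) :
    casoratian a F P (n + 1) - casoratian a F P n = F (n + 1) * residual a b z P n := by
  simp only [casoratian, residual]
  linear_combination -P (n + 1) * hF n

theorem IsSolution.casoratian_left_succ_sub (hF : IsSolution a b z F) (n : ℕ) :
    casoratian a M F (n + 1) - casoratian a M F n = -(F (n + 1) * residual a b z M n) := by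
  simp only [casoratian, residual]
  linear_combination M (n + 1) * hF n

end Solutions

/-- A recessive approximate solution `P` and a dominant one `M` of the Jacobi equation: their
quotient has size `D n`, which decreases to zero, their Casoratian tends to `κ ≠ 0`, and their
residuals are summable with the natural weights. -/
structure ApproxBasis (a b : ℕ → ℝ) (z : ℂ) (P M : ℕ → ℂ) (D : ℕ → ℝ) (κ : ℂ) : Prop where
  a_pos : ∀ n, 0 < a n
  pos : ∀ n, 0 < D n
  anti : Antitone D
  le_two_mul : ∀ᶠ n in atTop, D n ≤ 2 * D (n + 1)
  tendsto : Tendsto D atTop (𝓝 0)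
  norm_eq : ∀ n, ‖P n‖ = D n * ‖M n‖
  ne_zero : κ ≠ 0
  tendsto_casoratian : Tendsto (casoratian a M P) atTop (𝓝 κ)
  eventually_ne : ∀ᶠ n in atTop, M n ≠ 0
  summable_left : Summable fun n => ‖residual a b z P n‖ * ‖M (n + 1)‖
  summable_right : Summable fun n => ‖residual a b z M n‖ * ‖P (n + 1)‖

namespace ApproxBasis

variable {a b : ℕ → ℝ} {z : ℂ} {P M : ℕ → ℂ} {D : ℕ → ℝ} {κ : ℂ}

/-- From some index on, the coefficients of every solution with respect to `P` and `M` are nearly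
constant. -/
theorem exists_dichotomy (h : ApproxBasis a b z P M D κ) :
    ∃ (N : ℕ) (ε : ℕ → ℝ), Dichotomy (fun n => D (n + N)) ε ∧ casoratian a M P N ≠ 0 ∧
      ∀ F, IsSolution a b z F → NearlyConstant (fun n => D (n + N)) ε
        (fun n => casoratian a M F (n + N)) (fun n => casoratian a F P (n + N)) := by
  have hc : 0 < ‖κ‖ / 2 := by have := norm_pos_iff.2 h.ne_zero; positivity
  set c := ‖κ‖ / 2 with hcdef
  set e : ℕ → ℝ := fun n => (‖residual a b z P n‖ * ‖M (n + 1)‖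
    + ‖residual a b z M n‖ * ‖P (n + 1)‖) / c with he
  have hes : Summable e := (h.summable_left.add h.summable_right).div_const c
  have he0 : ∀ n, 0 ≤ e n := fun n => by positivity
  have hw : ∀ᶠ n in atTop, c < ‖casoratian a M P n‖ :=
    h.tendsto_casoratian.norm.eventually_const_lt (by have := norm_pos_iff.2 h.ne_zero; linarith)
  have ht : ∀ᶠ n in atTop, ∑' i, e (i + n) < 1 / 8 :=
    (tendsto_sum_nat_add e).eventually_lt_const (by norm_num)
  obtain ⟨N, hN⟩ := eventually_atTop.1 (hw.and (ht.and h.le_two_mul))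
  have hlow : ∀ n, c < ‖casoratian a M P (n + N)‖ := fun n => (hN _ (by omega)).1
  refine ⟨N, fun n => e (n + N), ⟨fun n => h.pos _, fun m n hmn => h.anti (by omega),
    fun n => ?_, h.tendsto.comp (tendsto_add_atTop_nat N), fun n => he0 _,
    (summable_nat_add_iff N).2 hes, (hN N le_rfl).2.1.le⟩, ?_, fun F hF => ?_⟩
  · have := (hN (n + N) (by omega)).2.2
    rwa [show n + 1 + N = n + N + 1 by omega]
  · intro h0
    have := hlow 0
    rw [zero_add, h0, norm_zero] at this
    linarith
  · have hFb : ∀ n, ‖F (n + N + 1)‖ ≤ (D (n + N + 1) * ‖casoratian a M F (n + N)‖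
        + ‖casoratian a F P (n + N)‖) * ‖M (n + N + 1)‖ / c := by
      intro n
      rw [le_div_iff₀ hc]
      calc ‖F (n + N + 1)‖ * c ≤ ‖F (n + N + 1)‖ * ‖casoratian a M P (n + N)‖ :=
            mul_le_mul_of_nonneg_left (hlow n).le (norm_nonneg _)
        _ = ‖casoratian a M P (n + N) * F (n + N + 1)‖ := by rw [norm_mul, mul_comm]
        _ ≤ ‖casoratian a M F (n + N)‖ * ‖P (n + N + 1)‖
              + ‖casoratian a F P (n + N)‖ * ‖M (n + N + 1)‖ := by
            rw [casoratian_mul_eq_succ, ← norm_mul, ← norm_mul]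
            exact norm_add_le _ _
        _ = _ := by rw [h.norm_eq]; ring
    have hs0 : ∀ n, 0 ≤ D (n + N + 1) * ‖casoratian a M F (n + N)‖
        + ‖casoratian a F P (n + N)‖ := fun n => by
      have := (h.pos (n + N + 1)).le
      positivity
    constructor
    · intro n
      rw [show n + 1 + N = n + N + 1 by omega, hF.casoratian_left_succ_sub, norm_neg, norm_mul]
      have h1 := mul_le_mul_of_nonneg_right (hFb n)
        (mul_nonneg (h.pos (n + N + 1)).le (norm_nonneg (residual a b z M (n + N))))
      have h2 : ‖residual a b z M (n + N)‖ * ‖P (n + N + 1)‖ / c ≤ e (n + N) := by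
        refine div_le_div_of_nonneg_right ?_ hc.le
        have : 0 ≤ ‖residual a b z P (n + N)‖ * ‖M (n + N + 1)‖ := by positivity
        linarith
      have h3 := mul_le_mul_of_nonneg_right h2 (hs0 n)
      rw [h.norm_eq] at h3
      calc _ = _ := by ring
        _ ≤ _ := h1
        _ = _ := by ring
        _ ≤ _ := h3
    · intro n
      rw [show n + 1 + N = n + N + 1 by omega, hF.casoratian_right_succ_sub, norm_mul]
      have h1 := mul_le_mul_of_nonneg_right (hFb n) (norm_nonneg (residual a b z P (n + N)))
      have h2 : ‖residual a b z P (n + N)‖ * ‖M (n + N + 1)‖ / c ≤ e (n + N) := by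
        refine div_le_div_of_nonneg_right ?_ hc.le
        have : 0 ≤ ‖residual a b z M (n + N)‖ * ‖P (n + N + 1)‖ := by positivity
        linarith
      have h3 := mul_le_mul_of_nonneg_right h2 (hs0 n)
      calc _ ≤ _ := h1
        _ = _ := by ring
        _ ≤ _ := h3

theorem exists_tendsto (h : ApproxBasis a b z P M D κ) {F : ℕ → ℂ} (hF : IsSolution a b z F) :
    (∃ l, Tendsto (casoratian a F P) atTop (𝓝 l)) ∧
      Tendsto (fun n => D n * ‖casoratian a M F n‖) atTop (𝓝 0) := by
  obtain ⟨N, ε, hd, -, hc⟩ := h.exists_dichotomy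
  obtain ⟨l, hl⟩ := (hc F hF).exists_tendsto_right hd
  exact ⟨⟨l, (tendsto_add_atTop_iff_nat N).1 hl⟩,
    (tendsto_add_atTop_iff_nat (f := fun n => D n * ‖casoratian a M F n‖) N).1
      ((hc F hF).tendsto_mul_left hd)⟩

/-- The dominant coefficient at infinity is a linear functional on the two-dimensional space of
solutions, so it has a nontrivial zero, and this zero is a recessive solution. -/
theorem exists_recessive (h : ApproxBasis a b z P M D κ) :
    ∃ f, IsSolution a b z f ∧ Tendsto (casoratian a M f) atTop (𝓝 κ) ∧
      Tendsto (fun n => ‖casoratian a f P n‖ / D n) atTop (𝓝 0) := by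
  obtain ⟨N, ε, hd, hN, hc⟩ := h.exists_dichotomy
  have h1 := solutionOf_isSolution h.a_pos b z 1 0
  have h2 := solutionOf_isSolution h.a_pos b z 0 1
  obtain ⟨l1, hl1⟩ := (h.exists_tendsto h1).1
  obtain ⟨l2, hl2⟩ := (h.exists_tendsto h2).1
  obtain ⟨F, hF, hF0, hFl⟩ : ∃ F, IsSolution a b z F ∧ F ≠ 0 ∧
      Tendsto (casoratian a F P) atTop (𝓝 0) := by
    by_cases hl : l1 = 0
    · exact ⟨_, h1, fun h0 => by simpa [solutionOf] using congrFun h0 0, hl ▸ hl1⟩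
    · refine ⟨_, h1.linear_comb h2 l2 (-l1), fun h0 => hl ?_, ?_⟩
      · simpa [solutionOf] using congrFun h0 1
      · have := (hl1.const_mul l2).add (hl2.const_mul (-l1))
        rw [show l2 * l1 + -l1 * l2 = 0 by ring] at this
        refine this.congr fun n => ?_
        simp only [casoratian]; ring
  obtain ⟨⟨l, hl0, hl⟩, hb⟩ := (hc F hF).recessive hd
    ((tendsto_add_atTop_iff_nat (f := casoratian a F P) N).2 hFl) (by
      by_contra! h0
      simp only [zero_add] at h0
      refine hF0 (hF.eq_zero h.a_pos (N := N) ?_ ?_)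
      · have := casoratian_mul_eq (a := a) (F := F) (P := P) (M := M) N
        simpa [h0.1, h0.2, hN] using this
      · have := casoratian_mul_eq_succ (a := a) (F := F) (P := P) (M := M) N
        simpa [h0.1, h0.2, hN] using this)
  replace hl := (tendsto_add_atTop_iff_nat (f := casoratian a M F) N).1 hl
  replace hb := (tendsto_add_atTop_iff_nat (f := fun n => ‖casoratian a F P n‖ / D n) N).1 hb
  refine ⟨_, hF.linear_comb hF (κ / l) 0, ?_, ?_⟩
  · have := hl.const_mul (κ / l)
    rw [div_mul_cancel₀ _ hl0] at this
    refine this.congr fun n => ?_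
    simp only [casoratian]; ring
  · have := hb.const_mul ‖κ / l‖
    rw [mul_zero] at this
    refine this.congr fun n => ?_
    rw [mul_div_assoc', ← norm_mul]
    congr 2
    simp only [casoratian]; ring

theorem isEquivalent_of_recessive (h : ApproxBasis a b z P M D κ) {f : ℕ → ℂ}
    (hα : Tendsto (casoratian a M f) atTop (𝓝 κ))
    (hβ : Tendsto (fun n => ‖casoratian a f P n‖ / D n) atTop (𝓝 0)) : f ~[atTop] P := by
  have hw := h.tendsto_casoratian
  have hwinv : Tendsto (fun n => (casoratian a M P n)⁻¹) atTop (𝓝 κ⁻¹) := hw.inv₀ h.ne_zero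
  have hwne : ∀ᶠ n in atTop, casoratian a M P n ≠ 0 := hw.eventually_ne h.ne_zero
  have e1 : (fun n => (casoratian a M f n - casoratian a M P n) * P n) =o[atTop] P := by
    have : Tendsto (fun n => casoratian a M f n - casoratian a M P n) atTop (𝓝 0) := by
      simpa using hα.sub hw
    simpa using ((isLittleO_one_iff ℂ).2 this).mul_isBigO (isBigO_refl P atTop)
  have e2 : (fun n => casoratian a f P n * M n) =o[atTop] P := by
    have h1 := ((isLittleO_one_iff ℝ).2 hβ).mul_isBigO (isBigO_refl (fun n => ‖P n‖) atTop)
    simp only [one_mul] at h1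
    refine (IsBigO.of_bound 1 (Eventually.of_forall fun n => ?_)).trans_isLittleO h1.of_norm_right
    rw [h.norm_eq, norm_mul, one_mul, Real.norm_of_nonneg
      (by have := (h.pos n).le; positivity)]
    refine le_of_eq ?_
    field_simp [(h.pos n).ne']
  have e3 := (hwinv.isBigO_one ℂ).mul_isLittleO (e1.add e2)
  simp only [one_mul] at e3
  refine e3.congr' ?_ EventuallyEq.rfl
  filter_upwards [hwne] with n hn
  have := casoratian_mul_eq (a := a) (F := f) (P := P) (M := M) n
  rw [Pi.sub_apply, inv_mul_eq_iff_eq_mul₀ hn]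
  linear_combination -this

/-- The asymptotics of an arbitrary solution, in terms of its Wronskian with the recessive one. -/
theorem isLittleO_sub (h : ApproxBasis a b z P M D κ) {f F : ℕ → ℂ} (hf : IsSolution a b z f)
    (hα : Tendsto (casoratian a M f) atTop (𝓝 κ))
    (hβ : Tendsto (fun n => ‖casoratian a f P n‖ / D n) atTop (𝓝 0))
    (hF : IsSolution a b z F) :
    (fun n => F n - wronskian a F f * κ⁻¹ * M n) =o[atTop] M := by
  obtain ⟨⟨l, hl⟩, hz⟩ := h.exists_tendsto hF
  have hw := h.tendsto_casoratian
  have hwinv : Tendsto (fun n => (casoratian a M P n)⁻¹) atTop (𝓝 κ⁻¹) := hw.inv₀ h.ne_zero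
  have hwne : ∀ᶠ n in atTop, casoratian a M P n ≠ 0 := hw.eventually_ne h.ne_zero
  have hprod : Tendsto (fun n => casoratian a M F n * casoratian a f P n) atTop (𝓝 0) := by
    rw [tendsto_zero_iff_norm_tendsto_zero]
    have := hz.mul hβ
    rw [mul_zero] at this
    refine this.congr fun n => ?_
    rw [norm_mul]
    field_simp [(h.pos n).ne']
  have hlW : l = wronskian a F f := by
    have h1 := (hl.mul hα).sub hprod
    have h2 := hw.mul_const (wronskian a F f)
    have h3 := tendsto_nhds_unique h1 (h2.congr fun n => casoratian_mul_wronskian hF hf n)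
    rw [sub_zero, mul_comm κ] at h3
    exact mul_right_cancel₀ h.ne_zero h3
  have e1 : (fun n => casoratian a M F n * P n) =o[atTop] M := by
    have h1 := ((isLittleO_one_iff ℝ).2 hz).mul_isBigO (isBigO_refl (fun n => ‖M n‖) atTop)
    simp only [one_mul] at h1
    refine (IsBigO.of_bound 1 (Eventually.of_forall fun n => ?_)).trans_isLittleO h1.of_norm_right
    rw [norm_mul, h.norm_eq, one_mul, Real.norm_of_nonneg
      (by have := (h.pos n).le; positivity)]
    exact le_of_eq (by ring)
  have e2 : (fun n => ((casoratian a M P n)⁻¹ * casoratian a F P n - wronskian a F f * κ⁻¹) * M n)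
      =o[atTop] M := by
    have : Tendsto (fun n => (casoratian a M P n)⁻¹ * casoratian a F P n
        - wronskian a F f * κ⁻¹) atTop (𝓝 0) := by
      have := (hwinv.mul hl).sub_const (wronskian a F f * κ⁻¹)
      rwa [hlW, mul_comm κ⁻¹, sub_self] at this
    simpa using ((isLittleO_one_iff ℂ).2 this).mul_isBigO (isBigO_refl M atTop)
  have e3 := (hwinv.isBigO_one ℂ).mul_isLittleO e1
  simp only [one_mul] at e3
  refine (e3.add e2).congr' ?_ EventuallyEq.rfl
  filter_upwards [hwne] with n hn
  have := casoratian_mul_eq (a := a) (F := F) (P := P) (M := M) n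
  have h2 : F n = (casoratian a M P n)⁻¹ * (casoratian a M F n * P n
      + casoratian a F P n * M n) := by
    rw [← this, inv_mul_cancel_left₀ hn]
  rw [h2]
  ring

theorem isBigO (h : ApproxBasis a b z P M D κ) : P =O[atTop] M := by
  refine IsBigO.of_bound (D 0) (Eventually.of_forall fun n => ?_)
  rw [h.norm_eq]
  exact mul_le_mul_of_nonneg_right (h.anti n.zero_le) (norm_nonneg _)

theorem eventually_ne_left (h : ApproxBasis a b z P M D κ) : ∀ᶠ n in atTop, P n ≠ 0 := by
  filter_upwards [h.eventually_ne] with n hn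
  rw [← norm_pos_iff, h.norm_eq]
  exact mul_pos (h.pos n) (norm_pos_iff.2 hn)

/-- A solution that is negligible compared with `P` vanishes: its Wronskian with the recessive
solution `f` is zero, so it is a multiple of `f`, and `f ~ P`. -/
theorem eq_zero_of_isLittleO (h : ApproxBasis a b z P M D κ) {d : ℕ → ℂ}
    (hd : IsSolution a b z d) (hdo : d =o[atTop] P) : d = 0 := by
  obtain ⟨f, hf, hα, hβ⟩ := h.exists_recessive
  have hfP := h.isEquivalent_of_recessive hα hβ
  have hW : wronskian a d f = 0 := by
    have h1 := (h.isLittleO_sub hf hα hβ hd).sub (hdo.trans_isBigO h.isBigO)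
    by_contra h0
    have hc : -(wronskian a d f * κ⁻¹) ≠ 0 := neg_ne_zero.2 (mul_ne_zero h0 (inv_ne_zero h.ne_zero))
    have h2 : (fun n => -(wronskian a d f * κ⁻¹) * M n) =o[atTop] M :=
      h1.congr_left fun n => by ring
    rw [isLittleO_const_mul_left_iff hc] at h2
    exact isLittleO_irrefl h.eventually_ne.frequently h2
  have hfne : ∀ᶠ n in atTop, f n ≠ 0 := by
    filter_upwards [hfP.symm.isBigO.eq_zero_imp, h.eventually_ne_left] with n h1 h2 h3
    exact h2 (h1 h3)
  obtain ⟨N, hN⟩ := eventually_atTop.1 hfne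
  have hstep : ∀ n ≥ N, d n = d N / f N * f n := by
    intro n hn
    induction n, hn using Nat.le_induction with
    | base => field_simp [hN N le_rfl]
    | succ n hn ih =>
      have h1 := wronskian_eq hd hf n
      rw [hW] at h1
      have h2 : (a n : ℂ) ≠ 0 := by exact_mod_cast (h.a_pos n).ne'
      have h3 := (mul_eq_zero.1 h1.symm).resolve_left h2
      have h4 := hN n hn
      rw [ih] at h3
      refine mul_right_cancel₀ h4 ?_
      linear_combination -h3
  have hlam : d N / f N = 0 := by
    by_contra h0
    have h1 : (fun n => d N / f N * f n) =o[atTop] P :=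
      hdo.congr' (eventually_atTop.2 ⟨N, hstep⟩) EventuallyEq.rfl
    rw [isLittleO_const_mul_left_iff h0] at h1
    exact isLittleO_irrefl h.eventually_ne_left.frequently (hfP.symm.isBigO.trans_isLittleO h1)
  refine hd.eq_zero h.a_pos (N := N) ?_ ?_
  · rw [hstep N le_rfl, hlam, zero_mul]
  · rw [hstep (N + 1) N.le_succ, hlam, zero_mul]

end ApproxBasis

/-! ### Sequences of power growth -/

/-- `f n = O(n ^ e)` as `n → ∞`, for a real exponent `e`. -/
def IsBigOPow {E : Type*} [NormedAddCommGroup E] (e : ℝ) (f : ℕ → E) : Prop :=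
  f =O[atTop] fun n : ℕ => (n : ℝ) ^ e

namespace IsBigOPow

section Group

variable {E : Type*} [NormedAddCommGroup E] {e e' : ℝ} {f g : ℕ → E}

theorem mono (h : IsBigOPow e f) (hee : e ≤ e') : IsBigOPow e' f := by
  refine IsBigO.trans h (IsBigO.of_bound 1 ?_)
  filter_upwards [eventually_ge_atTop 1] with n hn
  have hn' : (1 : ℝ) ≤ n := by exact_mod_cast hn
  rw [one_mul, Real.norm_of_nonneg (by positivity), Real.norm_of_nonneg (by positivity)]
  exact Real.rpow_le_rpow_of_exponent_le hn' hee

theorem add (hf : IsBigOPow e f) (hg : IsBigOPow e g) : IsBigOPow e fun n => f n + g n :=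
  IsBigO.add hf hg

theorem sub (hf : IsBigOPow e f) (hg : IsBigOPow e g) : IsBigOPow e fun n => f n - g n :=
  IsBigO.sub hf hg

theorem congr (hf : IsBigOPow e f) (h : ∀ n, f n = g n) : IsBigOPow e g :=
  IsBigO.congr_left hf h

theorem congr' (hf : IsBigOPow e f) (h : ∀ᶠ n in atTop, f n = g n) : IsBigOPow e g :=
  IsBigO.congr' hf h EventuallyEq.rfl

theorem tendsto_zero (hf : IsBigOPow e f) (he : e < 0) : Tendsto f atTop (𝓝 0) := by
  refine IsBigO.trans_tendsto hf ?_
  have := (tendsto_rpow_neg_atTop (neg_pos.2 he)).comp tendsto_natCast_atTop_atTop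
  simpa [Function.comp_def] using this

theorem of_tendsto {l : E} (hf : Tendsto f atTop (𝓝 l)) : IsBigOPow 0 f := by
  have := hf.isBigO_one ℝ
  simpa [IsBigOPow] using this

theorem const (c : E) : IsBigOPow 0 fun _ : ℕ => c := of_tendsto tendsto_const_nhds

theorem norm_summable (hf : IsBigOPow e f) (he : e < -1) : Summable fun n => ‖f n‖ :=
  summable_of_isBigO_nat (Real.summable_nat_rpow.2 he) hf.norm_left

end Group

section Ring

variable {𝕜 : Type*} [NormedField 𝕜] {e e' e'' : ℝ} {f g : ℕ → 𝕜}

theorem mul (hf : IsBigOPow e f) (hg : IsBigOPow e' g) (he : e + e' ≤ e'') :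
    IsBigOPow e'' fun n => f n * g n := by
  refine mono (e := e + e') ?_ he
  refine (IsBigO.mul hf hg).trans (IsBigO.of_bound 1 ?_)
  filter_upwards [eventually_gt_atTop 0] with n hn
  have hn' : (0 : ℝ) < n := by exact_mod_cast hn
  rw [one_mul, Real.rpow_add hn']

theorem const_mul (hf : IsBigOPow e f) (c : 𝕜) : IsBigOPow e fun n => c * f n :=
  (const c).mul hf (by simp)

end Ring

theorem ofReal {e : ℝ} {f : ℕ → ℝ} (hf : IsBigOPow e f) : IsBigOPow e fun n => (f n : ℂ) :=
  Complex.isBigO_ofReal_left.2 hf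

theorem rpow (e : ℝ) : IsBigOPow e fun n : ℕ => (n : ℝ) ^ e := isBigO_refl _ _

end IsBigOPow

/-- The binomial expansion of `(n + c) ^ s` up to the second order. -/
theorem isBigOPow_add_rpow (c s : ℝ) :
    IsBigOPow (s - 2) fun n : ℕ => ((n : ℝ) + c) ^ s - (n : ℝ) ^ s - s * c * (n : ℝ) ^ (s - 1) := by
  have h1 : (fun x : ℝ => (1 + x) ^ s - 1 - s * x) =O[𝓝 0] fun x => x ^ 2 := by
    have h := (Real.one_add_rpow_hasFPowerSeriesAt_zero (a := s)).isBigO_sub_partialSum_pow 2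
    simp only [FormalMultilinearSeries.partialSum, Finset.sum_range_succ, binomialSeries] at h
    refine (h.congr_left fun x => ?_).trans (IsBigO.of_bound 1 (by simp))
    simp
    ring
  have h2 : Tendsto (fun n : ℕ => c / (n : ℝ)) atTop (𝓝 0) :=
    tendsto_const_div_atTop_nhds_zero_nat c
  have h3 : IsBigOPow (-2) fun n : ℕ => (1 + c / (n : ℝ)) ^ s - 1 - s * (c / n) := by
    refine (h1.comp_tendsto h2).trans (IsBigO.of_bound (c ^ 2) ?_)
    filter_upwards [eventually_gt_atTop 0] with n hn
    have hn' : (0 : ℝ) < n := by exact_mod_cast hn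
    rw [Real.rpow_neg hn'.le, Real.rpow_two]
    simp [div_eq_mul_inv, mul_pow]
  refine ((IsBigOPow.rpow s).mul h3 (by linarith : s + -2 ≤ s - 2)).congr' ?_
  filter_upwards [eventually_gt_atTop 0, h2.eventually_const_lt (show (-1 : ℝ) < 0 by norm_num)]
    with n hn hc
  have hn' : (0 : ℝ) < n := by exact_mod_cast hn
  have h4 : ((n : ℝ) + c) = n * (1 + c / n) := by field_simp
  rw [h4, Real.mul_rpow hn'.le (by linarith), Real.rpow_sub hn', Real.rpow_one]
  field_simp

theorem isBigOPow_succ_rpow (s : ℝ) :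
    IsBigOPow (s - 2) fun n : ℕ => ((n + 1 : ℕ) : ℝ) ^ s - (n : ℝ) ^ s - s * (n : ℝ) ^ (s - 1) :=
  (isBigOPow_add_rpow 1 s).congr fun n => by push_cast; ring

theorem isBigOPow_rpow_sub_pred (s : ℝ) :
    IsBigOPow (s - 2) fun n : ℕ => (n : ℝ) ^ s - ((n - 1 : ℕ) : ℝ) ^ s - s * (n : ℝ) ^ (s - 1) := by
  refine ((isBigOPow_add_rpow (-1) s).const_mul (-1)).congr' ?_
  filter_upwards [eventually_gt_atTop 0] with n hn
  rw [Nat.cast_pred hn]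
  ring_nf

theorem isBigOPow_succ_rpow_sub (s : ℝ) :
    IsBigOPow (s - 1) fun n : ℕ => ((n + 1 : ℕ) : ℝ) ^ s - (n : ℝ) ^ s :=
  (((isBigOPow_succ_rpow s).mono (by linarith : s - 2 ≤ s - 1)).add
    ((IsBigOPow.rpow (s - 1)).const_mul s)).congr fun n => by ring

theorem isBigOPow_rpow_succ (s : ℝ) : IsBigOPow s fun n : ℕ => ((n + 1 : ℕ) : ℝ) ^ s :=
  (((isBigOPow_succ_rpow_sub s).mono (by linarith)).add (IsBigOPow.rpow s)).congr fun n => by ring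

theorem isBigOPow_rpow_sub_pred' (s : ℝ) :
    IsBigOPow (s - 1) fun n : ℕ => (n : ℝ) ^ s - ((n - 1 : ℕ) : ℝ) ^ s :=
  (((isBigOPow_rpow_sub_pred s).mono (by linarith : s - 2 ≤ s - 1)).add
    ((IsBigOPow.rpow (s - 1)).const_mul s)).congr fun n => by ring

theorem IsBigOPow.comp_succ {E : Type*} [NormedAddCommGroup E] {e : ℝ} {f : ℕ → E}
    (hf : IsBigOPow e f) : IsBigOPow e fun n => f (n + 1) :=
  (IsBigO.comp_tendsto hf (tendsto_add_atTop_nat 1)).trans (isBigOPow_rpow_succ e)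

theorem IsBigOPow.comp_pred {E : Type*} [NormedAddCommGroup E] {e : ℝ} {f : ℕ → E}
    (hf : IsBigOPow e f) : IsBigOPow e fun n => f (n - 1) := by
  refine (IsBigO.comp_tendsto hf (tendsto_sub_atTop_nat 1)).trans ?_
  exact ((IsBigOPow.rpow e).sub ((isBigOPow_rpow_sub_pred' e).mono (by linarith))).congr
    fun n => by simp

theorem IsBigOPow.exp_sub {e : ℝ} {u : ℕ → ℂ} (hu : IsBigOPow e u) (he : e < 0) :
    IsBigOPow (2 * e) fun n => Complex.exp (u n) - 1 - u n := by
  have h1 : (fun n => Complex.exp (u n) - 1 - u n) =O[atTop] fun n => u n * u n := by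
    refine IsBigO.of_bound 1 ?_
    have h2 := (hu.tendsto_zero he).norm
    rw [norm_zero] at h2
    filter_upwards [h2.eventually_le_const one_pos] with n hn
    rw [norm_mul, one_mul, ← sq]
    exact Complex.norm_exp_sub_one_sub_id_le hn
  exact h1.trans (hu.mul hu (by linarith))

/-! ### The residual of the Ansatz -/

/-- The weighted coefficient `a n * n ^ (-ρ) * (n + 1) ^ (-ρ)`. -/
noncomputable def weightedCoeff (a : ℕ → ℝ) (ρ : ℝ) (n : ℕ) : ℝ :=
  a n * (n : ℝ) ^ (-ρ) * ((n + 1 : ℕ) : ℝ) ^ (-ρ)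

/-- The residual of the Ansatz `n ^ (-ρ) * exp (i φ n)`, where `φ n - φ (n - 1) = θ n`, after
multiplication by `n ^ (-ρ) * exp (-i φ n)`; here `x` stands for the weighted off-diagonal
coefficients and `y` for the weighted diagonal ones, including the spectral parameter. -/
noncomputable def phaseResidual (x : ℕ → ℝ) (y θ : ℕ → ℂ) (n : ℕ) : ℂ :=
  x (n - 1) * Complex.exp (-(Complex.I * θ n)) + x n * Complex.exp (Complex.I * θ (n + 1)) - y n

section Coefficients

variable {a : ℕ → ℝ} {σ α ρ ν : ℝ}

theorem weightedCoeff_expansion (hρ : σ - 2 * ρ = ν)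
    (ha : IsBigOPow (σ - 2) fun n : ℕ => a n - (n : ℝ) ^ σ * (1 + α * (n : ℝ)⁻¹)) :
    IsBigOPow (ν - 2) fun n => weightedCoeff a ρ n - (n : ℝ) ^ ν - (α - ρ) * (n : ℝ) ^ (ν - 1) := by
  have hp := isBigOPow_succ_rpow (-ρ)
  have hq := IsBigOPow.rpow (-ρ)
  have hA : IsBigOPow σ fun n : ℕ => (n : ℝ) ^ σ * (1 + α * (n : ℝ)⁻¹) := by
    refine (IsBigOPow.rpow σ).mul (IsBigOPow.of_tendsto (l := 1 + α * 0) ?_) (by simp)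
    exact (tendsto_inv_atTop_nhds_zero_nat.const_mul α).const_add 1
  have t1 := (ha.mul hq (le_refl _)).mul (isBigOPow_rpow_succ (-ρ))
    (by linarith : σ - 2 + -ρ + -ρ ≤ ν - 2)
  have t2 := (hA.mul hq (le_refl _)).mul hp (by linarith : σ + -ρ + (-ρ - 2) ≤ ν - 2)
  have t3 : IsBigOPow (ν - 2) fun n : ℕ => -(α * ρ) * (n : ℝ) ^ (ν - 2) :=
    (IsBigOPow.rpow _).const_mul _
  refine ((t1.add t2).add t3).congr' ?_
  filter_upwards [eventually_gt_atTop 0] with n hn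
  have hn' : (0 : ℝ) < n := by exact_mod_cast hn
  have e1 : (n : ℝ) ^ ν = (n : ℝ) ^ σ * (n : ℝ) ^ (-ρ) * (n : ℝ) ^ (-ρ) := by
    rw [← Real.rpow_add hn', ← Real.rpow_add hn']
    congr 1
    linarith
  rw [weightedCoeff, Real.rpow_sub hn' ν, Real.rpow_sub hn' ν, Real.rpow_sub hn' (-ρ), e1,
    Real.rpow_one, Real.rpow_two]
  field_simp
  ring

/-- The normalised form of an expansion `x n = n ^ ν (1 + c / n + O(n ^ (-2)))`. -/
theorem rpow_neg_mul_expansion {x : ℕ → ℝ} {c : ℝ}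
    (hx : IsBigOPow (ν - 2) fun n : ℕ => x n - (n : ℝ) ^ ν - c * (n : ℝ) ^ (ν - 1)) :
    IsBigOPow (-2) fun n : ℕ => (n : ℝ) ^ (-ν) * x n - 1 - c * (n : ℝ)⁻¹ := by
  refine ((IsBigOPow.rpow (-ν)).mul hx (by linarith : -ν + (ν - 2) ≤ -2)).congr' ?_
  filter_upwards [eventually_gt_atTop 0] with n hn
  have hn' : (0 : ℝ) < n := by exact_mod_cast hn
  rw [Real.rpow_sub hn', Real.rpow_neg hn'.le, Real.rpow_one]
  field_simp

theorem rpow_neg_mul_sub_pred_expansion {x : ℕ → ℝ} {c : ℝ}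
    (hx : IsBigOPow (ν - 2) fun n : ℕ => x n - (n : ℝ) ^ ν - c * (n : ℝ) ^ (ν - 1)) :
    IsBigOPow (-2) fun n : ℕ => (n : ℝ) ^ (-ν) * (x n - x (n - 1)) - ν * (n : ℝ)⁻¹ := by
  have h1 := ((hx.sub hx.comp_pred).add (isBigOPow_rpow_sub_pred ν)).add
    (((isBigOPow_rpow_sub_pred' (ν - 1)).mono (by linarith : ν - 1 - 1 ≤ ν - 2)).const_mul c)
  refine ((IsBigOPow.rpow (-ν)).mul h1 (by linarith : -ν + (ν - 2) ≤ -2)).congr' ?_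
  filter_upwards [eventually_gt_atTop 0] with n hn
  have hn' : (0 : ℝ) < n := by exact_mod_cast hn
  rw [Real.rpow_sub hn', Real.rpow_neg hn'.le, Real.rpow_one]
  field_simp
  ring

end Coefficients

/-- The properties of the phase increments `θ n` on which the estimate of the residual rests: they
behave as `κ n ^ (-ν)`, their normalised version has summable increments, and they solve the
eikonal equation `2 - 2 cos (θ n) = t n` up to a small error. -/
structure IsPhase (ν ε : ℝ) (κ : ℂ) (t θ : ℕ → ℂ) : Prop where
  ν_pos : 0 < ν
  ν_le : ν ≤ 1 / 2
  ε_pos : 0 < ε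
  ε_le : ε ≤ ν
  tendsto : Tendsto (fun n : ℕ => (((n : ℝ) ^ ν : ℝ) : ℂ) * θ n) atTop (𝓝 κ)
  increment : IsBigOPow (-1 - ε) fun n : ℕ =>
    ((((n + 1 : ℕ) : ℝ) ^ ν : ℝ) : ℂ) * θ (n + 1) - (((n : ℝ) ^ ν : ℝ) : ℂ) * θ n
  eikonal : IsBigOPow (-1 - ν - ε) fun n => t n - (2 - 2 * Complex.cos (θ n))

namespace IsPhase

variable {ν ε : ℝ} {κ : ℂ} {t θ : ℕ → ℂ}

theorem neg (h : IsPhase ν ε κ t θ) : IsPhase ν ε (-κ) t fun n => -θ n where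
  ν_pos := h.ν_pos
  ν_le := h.ν_le
  ε_pos := h.ε_pos
  ε_le := h.ε_le
  tendsto := by simpa using h.tendsto.neg
  increment := (h.increment.const_mul (-1)).congr fun n => by ring
  eikonal := by simpa using h.eikonal

theorem isBigOPow (h : IsPhase ν ε κ t θ) : IsBigOPow (-ν) θ := by
  refine ((IsBigOPow.rpow (-ν)).ofReal.mul (IsBigOPow.of_tendsto h.tendsto)
    (by simp : -ν + 0 ≤ -ν)).congr' ?_
  filter_upwards [eventually_gt_atTop 0] with n hn
  have hn' : (0 : ℝ) < n := by exact_mod_cast hn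
  rw [← mul_assoc, ← Complex.ofReal_mul, ← Real.rpow_add hn']
  simp

/-- The increments of `θ` are, to leading order, those of the power `n ^ (-ν)`. -/
theorem succ_sub (h : IsPhase ν ε κ t θ) :
    IsBigOPow (-1 - ν - ε) fun n : ℕ => θ (n + 1) - θ n + ν * (n : ℂ)⁻¹ * θ n := by
  have := h.ε_le
  have := h.ν_le
  have h1 := h.increment.mul (isBigOPow_rpow_succ (-ν)).ofReal
    (by linarith : -1 - ε + -ν ≤ -1 - ν - ε)
  have h2 := (IsBigOPow.of_tendsto h.tendsto).mul (isBigOPow_succ_rpow (-ν)).ofReal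
    (by linarith : 0 + (-ν - 2) ≤ -1 - ν - ε)
  refine (h1.add h2).congr' ?_
  filter_upwards [eventually_gt_atTop 0] with n hn
  have hn' : (0 : ℝ) < n := by exact_mod_cast hn
  have e1 : ∀ m : ℕ, 0 < m → (((m : ℝ) ^ ν : ℝ) : ℂ) * (((m : ℝ) ^ (-ν) : ℝ) : ℂ) = 1 := by
    intro m hm
    rw [← Complex.ofReal_mul, ← Real.rpow_add (by exact_mod_cast hm)]
    simp
  have e2 : ((((n : ℝ) ^ (-ν - 1) : ℝ)) : ℂ) = (((n : ℝ) ^ (-ν) : ℝ) : ℂ) * (n : ℂ)⁻¹ := by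
    rw [Real.rpow_sub hn', Real.rpow_one]
    push_cast
    rw [div_eq_mul_inv]
  have e3 := e1 n hn
  have e4 := e1 (n + 1) n.succ_pos
  rw [Complex.ofReal_sub, Complex.ofReal_sub, Complex.ofReal_mul, e2, Complex.ofReal_neg]
  linear_combination θ (n + 1) * e4 + (-θ n + ν * θ n * (n : ℂ)⁻¹) * e3

/-- The main estimate: the terms of order `n ^ (-1)` and `n ^ (-σ)` in the residual are cancelled by
the eikonal equation, and those of order `n ^ (-1 - ν)` by the choice of the amplitude. -/
theorem phaseResidual (h : IsPhase ν ε κ t θ) {x : ℕ → ℝ} {y : ℕ → ℂ} {c : ℝ}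
    (hx : IsBigOPow (ν - 2) fun n : ℕ => x n - (n : ℝ) ^ ν - c * (n : ℝ) ^ (ν - 1))
    (hy : IsBigOPow (-2) fun n : ℕ => (((n : ℝ) ^ (-ν) : ℝ) : ℂ) * y n
      - (2 - t n + (2 * c - ν) * (n : ℂ)⁻¹)) :
    IsBigOPow (-1 - ε) (phaseResidual x y θ) := by
  have hε := h.ε_pos
  have hε' := h.ε_le
  have hν := h.ν_pos
  have hν' := h.ν_le
  have r1 := (rpow_neg_mul_expansion hx).ofReal
  have r2 := (rpow_neg_mul_sub_pred_expansion hx).ofReal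
  have hh : IsBigOPow (-1) fun n : ℕ => (n : ℂ)⁻¹ :=
    (IsBigOPow.rpow (-1)).ofReal.congr fun n => by rw [Real.rpow_neg_one]; simp
  have hθ : IsBigOPow (-ν) fun n => Complex.I * θ n := h.isBigOPow.const_mul _
  have hθ' : IsBigOPow (-ν) fun n => -(Complex.I * θ n) :=
    (hθ.const_mul (-1)).congr fun n => by ring
  have hneg : -ν < 0 := by linarith
  have ep := hθ.exp_sub hneg
  have em := hθ'.exp_sub hneg
  have hδ : IsBigOPow (-1 - ν) fun n => θ (n + 1) - θ n :=
    ((h.succ_sub.mono (by linarith)).sub ((hh.mul h.isBigOPow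
      (by linarith : -1 + -ν ≤ -1 - ν)).const_mul (ν : ℂ))).congr fun n => by ring
  have hIδ : IsBigOPow (-1 - ν) fun n => Complex.I * (θ (n + 1) - θ n) := hδ.const_mul _
  have eδ := hIδ.exp_sub (by linarith)
  have ep1 : IsBigOPow (-ν) fun n => Complex.exp (Complex.I * θ n) - 1 :=
    ((ep.mono (by linarith)).add hθ).congr fun n => by ring
  have ep0 : IsBigOPow 0 fun n => Complex.exp (Complex.I * θ n) :=
    ((ep1.mono (by linarith)).add (IsBigOPow.const 1)).congr fun n => by ring
  have em0 : IsBigOPow 0 fun n => Complex.exp (-(Complex.I * θ n)) :=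
    (((em.mono (by linarith)).add (hθ'.mono (by linarith))).add (IsBigOPow.const 1)).congr
      fun n => by ring
  have hdiff : IsBigOPow (-1 - ν - ε) fun n => Complex.exp (Complex.I * θ (n + 1))
      - Complex.exp (Complex.I * θ n) - Complex.I * (θ (n + 1) - θ n) :=
    ((ep0.mul eδ (by linarith : 0 + 2 * (-1 - ν) ≤ -1 - ν - ε)).add
      (ep1.mul hIδ (by linarith : -ν + (-1 - ν) ≤ -1 - ν - ε))).congr fun n => by
        have : Complex.exp (Complex.I * θ (n + 1))
            = Complex.exp (Complex.I * θ n) * Complex.exp (Complex.I * (θ (n + 1) - θ n)) := by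
          rw [← Complex.exp_add]; ring_nf
        rw [this]; ring
  have hdiff' : IsBigOPow (-1 - ν) fun n => Complex.exp (Complex.I * θ (n + 1))
      - Complex.exp (Complex.I * θ n) :=
    ((hdiff.mono (by linarith)).add hIδ).congr fun n => by ring
  have hcos : IsBigOPow (-2 * ν) fun n => 2 * Complex.cos (θ n) - 2 :=
    ((ep.add em).mono (by linarith)).congr fun n => by
      rw [Complex.cos, mul_comm (θ n), neg_mul, mul_comm (θ n)]; ring
  have q1 := h.eikonal
  have q2 := (hh.mul hcos (by linarith : -1 + -2 * ν ≤ -1 - ν - ε)).const_mul (c : ℂ)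
  have q4 := h.succ_sub.const_mul Complex.I
  have q5 := (hh.mul hdiff' (by linarith : -1 + (-1 - ν) ≤ -1 - ν - ε)).const_mul (c : ℂ)
  have q6 := (hh.mul em (by linarith : -1 + 2 * -ν ≤ -1 - ν - ε)).const_mul (ν : ℂ)
  have q7 := r1.mul (em0.add ((hdiff'.mono (by linarith)).add ep0))
    (by linarith : -2 + 0 ≤ -1 - ν - ε)
  have q8 := r2.mul em0 (by linarith : -2 + 0 ≤ -1 - ν - ε)
  have q9 := hy.mono (by linarith : -2 ≤ -1 - ν - ε)
  have hsum := (((((((q1.add q2).add hdiff).add q4).add q5).sub q6).add q7).sub q8).sub q9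
  refine ((IsBigOPow.rpow ν).ofReal.mul hsum
    (by linarith : ν + (-1 - ν - ε) ≤ -1 - ε)).congr' ?_
  filter_upwards [eventually_gt_atTop 0] with n hn
  have hn' : (0 : ℝ) < n := by exact_mod_cast hn
  have e3 : (((n : ℝ) ^ ν : ℝ) : ℂ) * (((n : ℝ) ^ (-ν) : ℝ) : ℂ) = 1 := by
    rw [← Complex.ofReal_mul, ← Real.rpow_add hn']
    simp
  have hc : 2 * Complex.cos (θ n)
      = Complex.exp (Complex.I * θ n) + Complex.exp (-(Complex.I * θ n)) := by
    rw [Complex.cos, mul_comm (θ n), neg_mul, mul_comm (θ n)]; ring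
  rw [CriticalJacobi.phaseResidual]
  push_cast
  generalize Complex.exp (Complex.I * θ (n + 1)) = A at *
  generalize Complex.exp (Complex.I * θ n) = B at *
  generalize Complex.exp (-(Complex.I * θ n)) = C at *
  generalize (((n : ℝ) ^ ν : ℝ) : ℂ) = N at *
  generalize (((n : ℝ) ^ (-ν) : ℝ) : ℂ) = N' at *
  rw [hc]
  linear_combination ((x (n - 1) : ℂ) * C + x n * A - y n) * e3

end IsPhase

/-! ### The branch of the square root -/

theorem upperSqrt_eq (t : ℂ) :
    upperSqrt t = (if 0 < t.im then 1 else -1) * (Real.sqrt ((‖t‖ + t.re) / 2) : ℂ)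
      + Complex.I * (Real.sqrt ((‖t‖ - t.re) / 2) : ℂ) := by
  rw [upperSqrt, Complex.sqrt_eq_real_add_ite]
  have h : (0 ≤ (-t).im) ↔ ¬ 0 < t.im := by simp
  by_cases ht : 0 < t.im
  · simp only [h, ht, norm_neg, Complex.neg_re, not_true, if_true, if_false, sub_neg_eq_add,
      ← sub_eq_add_neg]
    linear_combination -(Real.sqrt ((‖t‖ + t.re) / 2) : ℂ) * Complex.I_mul_I
  · simp only [h, ht, norm_neg, Complex.neg_re, not_false_iff, if_true, if_false, sub_neg_eq_add,
      ← sub_eq_add_neg]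
    linear_combination (Real.sqrt ((‖t‖ + t.re) / 2) : ℂ) * Complex.I_mul_I

theorem upperSqrt_im (t : ℂ) : (upperSqrt t).im = Real.sqrt ((‖t‖ - t.re) / 2) := by
  rw [upperSqrt_eq]
  split_ifs <;> simp

theorem upperSqrt_im_nonneg (t : ℂ) : 0 ≤ (upperSqrt t).im := by
  rw [upperSqrt_im]; positivity

theorem upperSqrt_sq_mul {c : ℝ} (hc : 0 < c) (t : ℂ) :
    upperSqrt (((c ^ 2 : ℝ) : ℂ) * t) = c * upperSqrt t := by
  have h0 : (0 : ℝ) ≤ c ^ 2 := by positivity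
  have him : 0 < c ^ 2 * t.im ↔ 0 < t.im := by
    constructor
    · exact fun h => pos_of_mul_pos_right h h0
    · exact fun h => by positivity
  rw [upperSqrt_eq, upperSqrt_eq, norm_mul, Complex.norm_real, Real.norm_of_nonneg h0,
    Complex.re_ofReal_mul, Complex.im_ofReal_mul, ← mul_add, ← mul_sub, mul_div_assoc,
    mul_div_assoc, Real.sqrt_mul h0, Real.sqrt_mul h0, Real.sqrt_sq hc.le]
  simp only [him]
  push_cast
  ring

theorem continuousAt_upperSqrt {t : ℂ} (ht : ∀ x : ℝ, 0 ≤ x → t ≠ x) :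
    ContinuousAt upperSqrt t := by
  have h : ContinuousAt Complex.sqrt (-t) := by
    refine Complex.continuousAt_sqrt ?_
    by_contra! h
    simp only [Complex.neg_re, Complex.neg_im, neg_eq_zero] at h
    exact ht t.re (by linarith) (Complex.ext (by simp) (by simp [h.2]))
  exact continuousAt_const.mul (ContinuousAt.comp (f := fun t : ℂ => -t) h
    continuous_neg.continuousAt)

/-- On the upper side of the cut `upperSqrt` takes the positive values of the square root. -/
theorem tendsto_upperSqrt_of_im_pos {G : ℕ → ℂ} {x : ℝ} (hx : 0 ≤ x)
    (hG : Tendsto G atTop (𝓝 x)) (him : ∀ᶠ n in atTop, 0 < (G n).im) :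
    Tendsto (fun n => upperSqrt (G n)) atTop (𝓝 (Real.sqrt x)) := by
  have hcont : Continuous fun t : ℂ => (Real.sqrt ((‖t‖ + t.re) / 2) : ℂ)
      + Complex.I * (Real.sqrt ((‖t‖ - t.re) / 2) : ℂ) := by fun_prop
  have h := (hcont.tendsto x).comp hG
  simp only [Complex.norm_real, Real.norm_of_nonneg hx, Complex.ofReal_re, add_self_div_two,
    sub_self, zero_div, Real.sqrt_zero, Complex.ofReal_zero, mul_zero, add_zero] at h
  refine h.congr' ?_
  filter_upwards [him] with n hn
  rw [upperSqrt_eq, if_pos hn, one_mul, Function.comp]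

theorem tendsto_upperSqrt_of_im_neg {G : ℕ → ℂ} {x : ℝ} (hx : 0 ≤ x)
    (hG : Tendsto G atTop (𝓝 x)) (him : ∀ᶠ n in atTop, (G n).im < 0) :
    Tendsto (fun n => upperSqrt (G n)) atTop (𝓝 (-(Real.sqrt x : ℂ))) := by
  have hcont : Continuous fun t : ℂ => -(Real.sqrt ((‖t‖ + t.re) / 2) : ℂ)
      + Complex.I * (Real.sqrt ((‖t‖ - t.re) / 2) : ℂ) := by fun_prop
  have h := (hcont.tendsto x).comp hG
  simp only [Complex.norm_real, Real.norm_of_nonneg hx, Complex.ofReal_re, add_self_div_two,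
    sub_self, zero_div, Real.sqrt_zero, Complex.ofReal_zero, mul_zero, add_zero] at h
  refine h.congr' ?_
  filter_upwards [him] with n hn
  rw [upperSqrt_eq, if_neg hn.not_gt, neg_one_mul, Function.comp]

/-! ### The eikonal equation -/

/-- The odd terms of the exponential sums cancel, and the even ones give the numbers `cosCoeff`. -/
theorem sum_range_exp_add_exp_neg (θ : ℂ) (L : ℕ) :
    ∑ m ∈ Finset.range (2 * (L + 1)), (Complex.I * θ) ^ m / (m.factorial : ℂ)
      + ∑ m ∈ Finset.range (2 * (L + 1)), (-(Complex.I * θ)) ^ m / (m.factorial : ℂ)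
      = 2 - ∑ k ∈ Finset.Icc 1 L, (cosCoeff k : ℂ) * (θ ^ 2) ^ k := by
  induction L with
  | zero => simp [Finset.sum_range_succ]; ring_nf
  | succ L ih =>
    rw [show 2 * (L + 1 + 1) = 2 * (L + 1) + 1 + 1 by ring, Finset.sum_range_succ,
      Finset.sum_range_succ, Finset.sum_range_succ _ (2 * (L + 1) + 1), Finset.sum_range_succ,
      Finset.sum_Icc_succ_top (by omega), ← sub_sub, ← ih, cosCoeff]
    have e1 : (Complex.I * θ) ^ (2 * (L + 1)) = (-1) ^ (L + 1) * (θ ^ 2) ^ (L + 1) := by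
      rw [pow_mul, mul_pow, Complex.I_sq, mul_pow]
    have e2 : (-(Complex.I * θ)) ^ (2 * (L + 1)) = (-1) ^ (L + 1) * (θ ^ 2) ^ (L + 1) := by
      rw [pow_mul, neg_sq, mul_pow, Complex.I_sq, mul_pow]
    have e3 : (-(Complex.I * θ)) ^ (2 * (L + 1) + 1) = -(Complex.I * θ) ^ (2 * (L + 1) + 1) :=
      Odd.neg_pow ⟨_, rfl⟩ _
    rw [e1, e2, e3]
    push_cast
    ring

/-- The Taylor expansion of `2 - 2 cos θ` in powers of `θ ^ 2`. -/
theorem isBigO_cos_sub_sum (L : ℕ) :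
    (fun θ : ℂ => 2 - 2 * Complex.cos θ - ∑ k ∈ Finset.Icc 1 L, (cosCoeff k : ℂ) * (θ ^ 2) ^ k)
      =O[𝓝 0] fun θ => (θ ^ 2) ^ (L + 1) := by
  set C : ℝ := (2 * (L + 1)).succ * ((2 * (L + 1)).factorial * (2 * (L + 1) : ℕ) : ℝ)⁻¹
  refine IsBigO.of_bound (C + C) ?_
  have h : ∀ᶠ θ : ℂ in 𝓝 0, ‖θ‖ ≤ 1 := by
    filter_upwards [Metric.ball_mem_nhds (0 : ℂ) one_pos] with θ hθ
    simpa using (mem_ball_zero_iff.1 hθ).le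
  filter_upwards [h] with θ hθ
  have h1 := Complex.exp_bound (x := Complex.I * θ) (by simpa using hθ)
    (n := 2 * (L + 1)) (by omega)
  have h2 := Complex.exp_bound (x := -(Complex.I * θ)) (by simpa using hθ)
    (n := 2 * (L + 1)) (by omega)
  rw [norm_neg] at h2
  have h3 : ‖Complex.I * θ‖ ^ (2 * (L + 1)) = ‖(θ ^ 2) ^ (L + 1)‖ := by
    rw [norm_mul, Complex.norm_I, one_mul, norm_pow, norm_pow, pow_mul]
  rw [h3] at h1 h2
  have hc : 2 * Complex.cos θ
      = Complex.exp (Complex.I * θ) + Complex.exp (-(Complex.I * θ)) := by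
    rw [Complex.cos, mul_comm θ, neg_mul, mul_comm θ]; ring
  have e : 2 - 2 * Complex.cos θ - ∑ k ∈ Finset.Icc 1 L, (cosCoeff k : ℂ) * (θ ^ 2) ^ k
      = -((Complex.exp (Complex.I * θ)
          - ∑ m ∈ Finset.range (2 * (L + 1)), (Complex.I * θ) ^ m / (m.factorial : ℂ))
        + (Complex.exp (-(Complex.I * θ))
          - ∑ m ∈ Finset.range (2 * (L + 1)), (-(Complex.I * θ)) ^ m / (m.factorial : ℂ))) := by
    linear_combination -hc - sum_range_exp_add_exp_neg θ L
  rw [e, norm_neg]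
  refine (norm_add_le _ _).trans ?_
  linarith

theorem eikonalPoly_one : eikonalPoly 1 = 0 := by simp [eikonalPoly]

theorem cosCoeff_one : cosCoeff 1 = 1 := by norm_num [cosCoeff]

theorem IsBigOPow.pow {e : ℝ} {f : ℕ → ℂ} (hf : IsBigOPow e f) (k : ℕ) :
    IsBigOPow (k * e) fun n => f n ^ k := by
  induction k with
  | zero => simpa using IsBigOPow.const (1 : ℂ)
  | succ k ih =>
    simp only [pow_succ]
    exact ih.mul hf (by push_cast; linarith)

/-- If `θ ^ 2 = t + P_L(t)`, then `2 - 2 cos θ = t + O(t ^ (L + 1))`. -/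
theorem eikonal_of_sq_eq {e : ℝ} (he : e < 0) {t θ : ℕ → ℂ} {L : ℕ} (hL : 1 ≤ L)
    (ht : IsBigOPow e t) (hθ : IsBigOPow (e / 2) θ)
    (hsq : ∀ n, θ n ^ 2 = t n + aeval (t n) (eikonalPoly L)) :
    IsBigOPow ((L + 1 : ℕ) * e) fun n => t n - (2 - 2 * Complex.cos (θ n)) := by
  obtain ⟨q, hq⟩ := (eikonalPoly_spec L).2.2
  have h1 : IsBigOPow ((L + 1 : ℕ) * e) fun n => 2 - 2 * Complex.cos (θ n)
      - ∑ k ∈ Finset.Icc 1 L, (cosCoeff k : ℂ) * (θ n ^ 2) ^ k := by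
    refine ((isBigO_cos_sub_sum L).comp_tendsto (hθ.tendsto_zero (by linarith))).trans ?_
    refine (((hθ.pow 2).mono ?_).pow (L + 1))
    push_cast; linarith
  have hb : IsBigOPow 0 fun n => aeval (t n) q :=
    IsBigOPow.of_tendsto (((Polynomial.continuous_aeval q).tendsto 0).comp (ht.tendsto_zero he))
  have h2 := (ht.pow (L + 1)).mul hb (add_zero _).le
  refine ((h1.add h2).const_mul (-1)).congr fun n => ?_
  have h3 := congrArg (aeval (t n)) hq
  simp only [map_add, map_sum, map_mul, map_pow, aeval_X, aeval_C, Complex.coe_algebraMap] at h3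
  have h4 : Finset.Ioc 1 L = Finset.Icc 2 L := by ext; simp; omega
  rw [← h3, ← Finset.add_sum_Ioc_eq_sum_Icc hL, cosCoeff_one, h4]
  simp only [hsq, add_comm (t n) (aeval (t n) (eikonalPoly L))]
  push_cast
  ring

/-! ### Asymptotics of the phases -/

theorem tendsto_natCast_rpow {c : ℝ} (hc : c ≤ 0) :
    Tendsto (fun n : ℕ => (((n : ℝ) ^ c : ℝ) : ℂ)) atTop (𝓝 (if c = 0 then 1 else 0)) := by
  split_ifs with h
  · simp [h]
  · exact (IsBigOPow.rpow c).ofReal.tendsto_zero (lt_of_le_of_ne hc h)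

theorem isBigOPow_rpow_increment {c ε : ℝ} (hc : c = 0 ∨ c ≤ -ε) :
    IsBigOPow (-1 - ε) fun n : ℕ =>
      ((((n + 1 : ℕ) : ℝ) ^ c : ℝ) : ℂ) - (((n : ℝ) ^ c : ℝ) : ℂ) := by
  rcases hc with rfl | hc
  · simpa using (IsBigOPow.const (0 : ℂ)).mul (IsBigOPow.rpow (-1 - ε)).ofReal (zero_add _).le
  · exact ((isBigOPow_succ_rpow_sub c).mono (by linarith : c - 1 ≤ -1 - ε)).ofReal.congr
      fun n => by push_cast; ring

/-- A sequence whose squares have increments of order `n ^ e` has itself increments of this order,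
provided that its limit is not zero. -/
theorem IsBigOPow.increment_of_sq {e : ℝ} {g : ℕ → ℂ} {κ : ℂ} (hκ : κ ≠ 0)
    (hg : Tendsto g atTop (𝓝 κ)) (h : IsBigOPow e fun n => g (n + 1) ^ 2 - g n ^ 2) :
    IsBigOPow e fun n => g (n + 1) - g n := by
  have hsum : Tendsto (fun n => g (n + 1) + g n) atTop (𝓝 (κ + κ)) :=
    (hg.comp (tendsto_add_atTop_nat 1)).add hg
  have h2 : κ + κ ≠ 0 := by rw [← two_mul]; exact mul_ne_zero two_ne_zero hκ
  refine (h.mul (IsBigOPow.of_tendsto (hsum.inv₀ h2)) (add_zero e).le).congr' ?_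
  filter_upwards [hsum.eventually_ne h2] with n hn
  rw [mul_inv_eq_iff_eq_mul₀ hn]
  ring

section Phase

variable {σ τ ε : ℝ} {L : ℕ} {w : ℂ}

theorem tSeq_isBigOPow : IsBigOPow (-min σ 1) (tSeq σ τ w) := by
  have h1 : IsBigOPow (-1) fun n : ℕ => (n : ℂ)⁻¹ :=
    (IsBigOPow.rpow (-1)).ofReal.congr fun n => by rw [Real.rpow_neg_one]; simp
  have h2 := (IsBigOPow.rpow (-σ)).ofReal.const_mul w
  refine (((h1.mono (neg_le_neg (min_le_right σ 1))).const_mul (-(τ : ℂ))).add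
    (h2.mono (neg_le_neg (min_le_left σ 1)))).congr fun n => ?_
  rw [tSeq, div_eq_mul_inv]

theorem tSeq_increment :
    IsBigOPow (-1 - min σ 1) fun n => tSeq σ τ w (n + 1) - tSeq σ τ w n := by
  have h1 := ((isBigOPow_succ_rpow_sub (-1)).mono
    (by linarith [min_le_right σ 1] : (-1 : ℝ) - 1 ≤ -1 - min σ 1)).ofReal.const_mul (-(τ : ℂ))
  have h2 := ((isBigOPow_succ_rpow_sub (-σ)).mono
    (by linarith [min_le_left σ 1] : -σ - 1 ≤ -1 - min σ 1)).ofReal.const_mul w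
  refine (h1.add h2).congr fun n => ?_
  simp only [tSeq, Real.rpow_neg_one]
  push_cast
  ring

/-- The limit of `n ^ min σ 1 * t n`. -/
noncomputable def tLimit (σ τ : ℝ) (w : ℂ) : ℂ :=
  -(τ : ℂ) * (if min σ 1 - 1 = 0 then 1 else 0) + w * (if min σ 1 - σ = 0 then 1 else 0)

theorem rpow_mul_tSeq :
    ∀ᶠ n : ℕ in atTop, (((n : ℝ) ^ min σ 1 : ℝ) : ℂ) * tSeq σ τ w n
      = -(τ : ℂ) * (((n : ℝ) ^ (min σ 1 - 1) : ℝ) : ℂ)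
        + w * (((n : ℝ) ^ (min σ 1 - σ) : ℝ) : ℂ) := by
  filter_upwards [eventually_gt_atTop 0] with n hn
  have hn' : (0 : ℝ) < n := by exact_mod_cast hn
  rw [tSeq, Real.rpow_sub hn', Real.rpow_sub hn', Real.rpow_neg hn'.le, Real.rpow_one]
  push_cast
  ring

theorem tendsto_rpow_mul_tSeq :
    Tendsto (fun n : ℕ => (((n : ℝ) ^ min σ 1 : ℝ) : ℂ) * tSeq σ τ w n) atTop
      (𝓝 (tLimit σ τ w)) :=
  (((tendsto_natCast_rpow (by linarith [min_le_right σ 1])).const_mul (-(τ : ℂ))).add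
    ((tendsto_natCast_rpow (by linarith [min_le_left σ 1])).const_mul w)).congr'
      (rpow_mul_tSeq.mono fun _ h => h.symm)

theorem rpow_mul_tSeq_increment (h1 : min σ 1 - 1 = 0 ∨ min σ 1 - 1 ≤ -ε)
    (h2 : min σ 1 - σ = 0 ∨ min σ 1 - σ ≤ -ε) :
    IsBigOPow (-1 - ε) fun n : ℕ => ((((n + 1 : ℕ) : ℝ) ^ min σ 1 : ℝ) : ℂ) * tSeq σ τ w (n + 1)
      - (((n : ℝ) ^ min σ 1 : ℝ) : ℂ) * tSeq σ τ w n := by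
  have h := (((isBigOPow_rpow_increment h1).const_mul (-(τ : ℂ))).add
    ((isBigOPow_rpow_increment h2).const_mul w))
  refine h.congr' ?_
  filter_upwards [rpow_mul_tSeq, (tendsto_add_atTop_nat 1).eventually rpow_mul_tSeq] with n e1 e2
  rw [e1, e2]
  ring

/-- For `σ ≥ 1` the correction to `t n` is the one of order `L = 1`, which vanishes; so the three
regimes of `σ` differ only in the value of `min σ 1`. -/
theorem exists_TSeq_eq (hσ : 0 < σ) (hL : σ < 1 → 1 < ((L : ℝ) + 1 / 2) * σ) (τ : ℝ) (w : ℂ) :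
    ∃ l : ℕ, 1 ≤ l ∧ 1 < ((l : ℝ) + 1 / 2) * min σ 1 ∧
      ∀ n, TSeq σ τ L w n = tSeq σ τ w n + aeval (tSeq σ τ w n) (eikonalPoly l) := by
  by_cases h : σ < 1
  · refine ⟨L, ?_, by rw [min_eq_left h.le]; exact hL h, fun n => by rw [TSeq, if_pos h]⟩
    by_contra! h0
    have h1 := hL h
    rw [Nat.lt_one_iff.1 h0] at h1
    norm_num at h1
    linarith
  · refine ⟨1, le_rfl, ?_, fun n => by rw [TSeq, if_neg h, eikonalPoly_one]; simp⟩
    rw [min_eq_right (not_lt.1 h)]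
    norm_num

theorem exists_TSeq_eq_mul (σ : ℝ) (L : ℕ) (τ : ℝ) (w : ℂ) :
    ∃ q : ℝ[X], ∀ n, TSeq σ τ L w n
      = tSeq σ τ w n * (1 + tSeq σ τ w n * aeval (tSeq σ τ w n) q) := by
  obtain ⟨q, hq⟩ := (eikonalPoly_spec L).1
  by_cases h : σ < 1
  · refine ⟨q, fun n => ?_⟩
    rw [TSeq, if_pos h, hq]
    simp
    ring
  · exact ⟨0, fun n => by rw [TSeq, if_neg h]; simp⟩

theorem tSeq_tendsto_zero (hσ : 0 < σ) : Tendsto (tSeq σ τ w) atTop (𝓝 0) :=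
  tSeq_isBigOPow.tendsto_zero (neg_lt_zero.2 (lt_min hσ one_pos))

theorem tendsto_rpow_mul_TSeq (hσ : 0 < σ) :
    Tendsto (fun n : ℕ => (((n : ℝ) ^ min σ 1 : ℝ) : ℂ) * TSeq σ τ L w n) atTop
      (𝓝 (tLimit σ τ w)) := by
  obtain ⟨q, hq⟩ := exists_TSeq_eq_mul σ L τ w
  have ht := tSeq_tendsto_zero (τ := τ) (w := w) hσ
  have hU : Tendsto (fun n => 1 + tSeq σ τ w n * aeval (tSeq σ τ w n) q) atTop (𝓝 1) := by
    simpa using (ht.mul (((Polynomial.continuous_aeval q).tendsto 0).comp ht)).const_add 1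
  have := (tendsto_rpow_mul_tSeq (σ := σ) (τ := τ) (w := w)).mul hU
  rw [mul_one] at this
  exact this.congr fun n => by rw [hq]; ring

theorem rpow_mul_TSeq_increment (hσ : 0 < σ) (hε : ε ≤ min σ 1)
    (h1 : min σ 1 - 1 = 0 ∨ min σ 1 - 1 ≤ -ε) (h2 : min σ 1 - σ = 0 ∨ min σ 1 - σ ≤ -ε) :
    IsBigOPow (-1 - ε) fun n : ℕ => ((((n + 1 : ℕ) : ℝ) ^ min σ 1 : ℝ) : ℂ) * TSeq σ τ L w (n + 1)
      - (((n : ℝ) ^ min σ 1 : ℝ) : ℂ) * TSeq σ τ L w n := by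
  obtain ⟨q, hq⟩ := exists_TSeq_eq_mul σ L τ w
  have ht := tSeq_tendsto_zero (τ := τ) (w := w) hσ
  have ht' := ht.comp (tendsto_add_atTop_nat 1)
  have hU : IsBigOPow 0 fun n => 1 + tSeq σ τ w (n + 1) * aeval (tSeq σ τ w (n + 1)) q :=
    IsBigOPow.of_tendsto
      ((ht'.mul (((Polynomial.continuous_aeval q).tendsto 0).comp ht')).const_add 1)
  have hD : IsBigOPow (-1 - ε) fun n =>
      tSeq σ τ w (n + 1) * aeval (tSeq σ τ w (n + 1)) q
        - tSeq σ τ w n * aeval (tSeq σ τ w n) q := by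
    have h3 := ((Polynomial.hasStrictDerivAt_aeval (X * q) (0 : ℂ)).hasStrictFDerivAt.isBigO_sub)
    have h4 := h3.comp_tendsto (ht'.prodMk_nhds ht)
    refine IsBigOPow.mono (e := -1 - min σ 1) ?_ (by linarith)
    refine IsBigO.trans ?_ (tSeq_increment (τ := τ) (w := w))
    simpa [Function.comp_def] using h4
  have hs := rpow_mul_tSeq_increment (τ := τ) (w := w) h1 h2
  have hs0 := IsBigOPow.of_tendsto (tendsto_rpow_mul_tSeq (σ := σ) (τ := τ) (w := w))
  refine ((hs.mul hU (add_zero _).le).add (hs0.mul hD (zero_add _).le)).congr fun n => ?_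
  rw [hq, hq]
  ring

/-- The branch of the root is positively homogeneous, so it commutes with the normalisation. -/
theorem rpow_half_mul_theta :
    ∀ᶠ n : ℕ in atTop, (((n : ℝ) ^ (min σ 1 / 2) : ℝ) : ℂ) * theta σ τ L w n
      = upperSqrt ((((n : ℝ) ^ min σ 1 : ℝ) : ℂ) * TSeq σ τ L w n) := by
  filter_upwards [eventually_gt_atTop 0] with n hn
  have hn' : (0 : ℝ) < n := by exact_mod_cast hn
  rw [theta, ← upperSqrt_sq_mul (Real.rpow_pos_of_pos hn' _), ← Real.rpow_natCast,
    ← Real.rpow_mul hn'.le]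
  congr 5
  push_cast
  ring

/-- The phases satisfy the requirements of the residual estimate as soon as they have the right
leading term. -/
theorem exists_isPhase (hσ : 0 < σ) (hL : σ < 1 → 1 < ((L : ℝ) + 1 / 2) * σ) {κ : ℂ} (hκ : κ ≠ 0)
    (hlim : Tendsto (fun n : ℕ => (((n : ℝ) ^ (min σ 1 / 2) : ℝ) : ℂ) * theta σ τ L w n) atTop
      (𝓝 κ)) :
    ∃ ε, IsPhase (min σ 1 / 2) ε κ (tSeq σ τ w) (theta σ τ L w) := by
  obtain ⟨l, hl1, hl, hT⟩ := exists_TSeq_eq hσ hL τ w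
  have hμ : 0 < min σ 1 := lt_min hσ one_pos
  have hμ1 := min_le_right σ 1
  set μ := min σ 1 with hμdef
  -- The three bounds on `ε` come from the products of two phases, from the eikonal remainder, and
  -- from the increments of the two powers in `n ^ μ * t n`, one of which is constant.
  obtain ⟨ε, hε, e1, e2, e3, e4⟩ : ∃ ε, 0 < ε ∧ ε ≤ μ / 2 ∧ ε ≤ ((l : ℝ) + 1 / 2) * μ - 1 ∧
      (μ - 1 = 0 ∨ μ - 1 ≤ -ε) ∧ (μ - σ = 0 ∨ μ - σ ≤ -ε) := by
    rcases lt_trichotomy σ 1 with h | h | h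
    · have hm : μ = σ := min_eq_left h.le
      refine ⟨min (min (μ / 2) (((l : ℝ) + 1 / 2) * μ - 1)) (1 - σ), by
        refine lt_min (lt_min ?_ ?_) ?_ <;> linarith, (min_le_left _ _).trans (min_le_left _ _),
        (min_le_left _ _).trans (min_le_right _ _), Or.inr ?_, Or.inl ?_⟩
      · linarith [min_le_right (min (μ / 2) (((l : ℝ) + 1 / 2) * μ - 1)) (1 - σ)]
      · linarith
    · have hm : μ = 1 := by rw [hμdef, h, min_self]
      exact ⟨min (μ / 2) (((l : ℝ) + 1 / 2) * μ - 1), by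
        refine lt_min ?_ ?_ <;> linarith, min_le_left _ _, min_le_right _ _,
        Or.inl (by linarith), Or.inl (by linarith)⟩
    · have hm : μ = 1 := min_eq_right h.le
      refine ⟨min (min (μ / 2) (((l : ℝ) + 1 / 2) * μ - 1)) (σ - 1), by
        refine lt_min (lt_min ?_ ?_) ?_ <;> linarith, (min_le_left _ _).trans (min_le_left _ _),
        (min_le_left _ _).trans (min_le_right _ _), Or.inl ?_, Or.inr ?_⟩
      · linarith
      · linarith [min_le_right (min (μ / 2) (((l : ℝ) + 1 / 2) * μ - 1)) (σ - 1)]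
  have hsq : ∀ n : ℕ, ((((n : ℝ) ^ (μ / 2) : ℝ) : ℂ) * theta σ τ L w n) ^ 2
      = (((n : ℝ) ^ μ : ℝ) : ℂ) * TSeq σ τ L w n := by
    intro n
    rw [mul_pow, theta, upperSqrt_sq, ← Complex.ofReal_pow, ← Real.rpow_natCast,
      ← Real.rpow_mul n.cast_nonneg]
    congr 4
    push_cast
    ring
  have hθ : IsBigOPow (-μ / 2) (theta σ τ L w) := by
    refine ((IsBigOPow.rpow (-(μ / 2))).ofReal.mul (IsBigOPow.of_tendsto hlim)
      (by linarith : -(μ / 2) + 0 ≤ -μ / 2)).congr' ?_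
    filter_upwards [eventually_gt_atTop 0] with n hn
    have hn' : (0 : ℝ) < n := by exact_mod_cast hn
    rw [← mul_assoc, ← Complex.ofReal_mul, ← Real.rpow_add hn']
    simp
  refine ⟨ε, by linarith, by linarith, hε, e1, hlim, ?_, ?_⟩
  · refine IsBigOPow.increment_of_sq hκ hlim ?_
    refine (rpow_mul_TSeq_increment (τ := τ) (L := L) (w := w) hσ (by linarith) e3 e4).congr
      fun n => ?_
    rw [hsq, hsq]
  · refine (eikonal_of_sq_eq (e := -μ) (by linarith) hl1 tSeq_isBigOPow hθ fun n => ?_).mono ?_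
    · rw [theta, upperSqrt_sq, hT]
    · push_cast
      linarith

end Phase

section Leading

variable {σ τ : ℝ} {L : ℕ} {w : ℂ}

theorem theta_im_nonneg (n : ℕ) : 0 ≤ (theta σ τ L w n).im := upperSqrt_im_nonneg _

theorem IsRegularPoint.pos {γ : ℝ} (h : IsRegularPoint σ τ γ w) : 0 < σ := by
  rcases h with h | h | h <;> linarith [h.1]

/-- The case in which the limit of `n ^ min σ 1 * T n` is off the cut of the square root: the
imaginary parts of the phases are then of the same order as the phases. -/
theorem theta_leading_of_ne (hσ : 0 < σ) (hS : ∀ x : ℝ, 0 ≤ x → tLimit σ τ w ≠ x) :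
    Tendsto (fun n : ℕ => (((n : ℝ) ^ (min σ 1 / 2) : ℝ) : ℂ) * theta σ τ L w n) atTop
        (𝓝 (upperSqrt (tLimit σ τ w))) ∧ upperSqrt (tLimit σ τ w) ≠ 0 ∧
      ∃ c > 0, ∀ᶠ n : ℕ in atTop, c / (n : ℝ) ≤ (theta σ τ L w n).im := by
  have hlim := ((continuousAt_upperSqrt hS).tendsto.comp
    (tendsto_rpow_mul_TSeq (L := L) hσ)).congr'
      ((rpow_half_mul_theta (σ := σ) (τ := τ) (L := L) (w := w)).mono fun _ h => h.symm)
  have him := upperSqrt_im_pos hS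
  refine ⟨hlim, fun h0 => by simp [h0] at him, _, half_pos him, ?_⟩
  have h1 := (Complex.continuous_im.tendsto _).comp hlim
  filter_upwards [h1.eventually_const_lt (half_lt_self him), eventually_ge_atTop 1] with n hn hn1
  have hn' : (1 : ℝ) ≤ n := by exact_mod_cast hn1
  rw [Function.comp, Complex.im_ofReal_mul] at hn
  rw [div_le_iff₀ (by linarith), mul_comm]
  refine hn.le.trans (mul_le_mul_of_nonneg_right ?_ (upperSqrt_im_nonneg _))
  refine (Real.rpow_le_rpow_of_exponent_le hn' ?_).trans (Real.rpow_one _).le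
  linarith [min_le_right σ 1]

/-- The case in which the limit of `n * T n` is positive and is approached from one side of the cut.
The imaginary parts of the phases are of order `n ^ (1 / 2 - σ)` only, and this is where
`σ ≤ 3 / 2` is needed. -/
theorem theta_leading_of_neg (hσ : 1 < σ) (hσ' : σ ≤ 3 / 2) (hτ : τ < 0) (hw : w.im ≠ 0) :
    Tendsto (fun n : ℕ => (((n : ℝ) ^ (min σ 1 / 2) : ℝ) : ℂ) * theta σ τ L w n) atTop
        (𝓝 (kappa σ τ w)) ∧ kappa σ τ w ≠ 0 ∧
      ∃ c > 0, ∀ᶠ n : ℕ in atTop, c / (n : ℝ) ≤ (theta σ τ L w n).im := by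
  have hT : ∀ n, TSeq σ τ L w n = tSeq σ τ w n := fun n => by rw [TSeq, if_neg hσ.not_gt]
  have hTim : ∀ n, (TSeq σ τ L w n).im = w.im * (n : ℝ) ^ (-σ) := by
    intro n
    rw [hT, tSeq, ← Complex.ofReal_neg, ← Complex.ofReal_natCast, ← Complex.ofReal_div,
      Complex.add_im, Complex.ofReal_im, Complex.im_mul_ofReal, zero_add]
  have hlimG : tLimit σ τ w = ((|τ| : ℝ) : ℂ) := by
    rw [tLimit, min_eq_right hσ.le, abs_of_neg hτ, if_pos (sub_self _), if_neg (by linarith)]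
    push_cast; ring
  have hG := tendsto_rpow_mul_TSeq (σ := σ) (τ := τ) (L := L) (w := w) (by linarith)
  rw [hlimG] at hG
  have hGim : ∀ n : ℕ, ((((n : ℝ) ^ min σ 1 : ℝ) : ℂ) * TSeq σ τ L w n).im
      = w.im * ((n : ℝ) ^ min σ 1 * (n : ℝ) ^ (-σ)) := fun n => by
    rw [Complex.im_ofReal_mul, hTim]; ring
  have hlim : Tendsto (fun n : ℕ => (((n : ℝ) ^ (min σ 1 / 2) : ℝ) : ℂ) * theta σ τ L w n) atTop
      (𝓝 (kappa σ τ w)) := by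
    refine Tendsto.congr' ((rpow_half_mul_theta (σ := σ)).mono fun _ h => h.symm) ?_
    rw [kappa, if_pos hσ, if_pos hτ]
    rcases lt_or_gt_of_ne hw with h | h
    · rw [if_neg h.not_ge]
      refine tendsto_upperSqrt_of_im_neg (abs_nonneg τ) hG ?_
      filter_upwards [eventually_gt_atTop 0] with n hn
      have hn' : (0 : ℝ) < n := by exact_mod_cast hn
      rw [hGim]
      exact mul_neg_of_neg_of_pos h (by positivity)
    · rw [if_pos h.le]
      refine tendsto_upperSqrt_of_im_pos (abs_nonneg τ) hG ?_
      filter_upwards [eventually_gt_atTop 0] with n hn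
      have hn' : (0 : ℝ) < n := by exact_mod_cast hn
      rw [hGim]
      positivity
  have hκ : kappa σ τ w ≠ 0 := by
    have : Real.sqrt |τ| ≠ 0 := (Real.sqrt_pos.2 (abs_pos.2 hτ.ne)).ne'
    rw [kappa, if_pos hσ, if_pos hτ]
    split_ifs <;> simpa using hτ.ne
  refine ⟨hlim, hκ, ?_⟩
  set K := ‖kappa σ τ w‖ + 1 with hK
  have hKpos : 0 < K := by positivity
  refine ⟨|w.im| / (2 * K), by positivity, ?_⟩
  filter_upwards [hlim.norm.eventually_lt_const (show ‖kappa σ τ w‖ < K by linarith),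
    eventually_ge_atTop 1] with n hn hn1
  have hn' : (1 : ℝ) ≤ n := by exact_mod_cast hn1
  have hn0 : (0 : ℝ) < n := by linarith
  have him : 0 ≤ (theta σ τ L w n).im := theta_im_nonneg n
  rw [min_eq_right hσ.le, norm_mul, Complex.norm_real, Real.norm_of_nonneg (by positivity)] at hn
  have hsq : 2 * (theta σ τ L w n).re * (theta σ τ L w n).im = w.im * (n : ℝ) ^ (-σ) := by
    rw [← hTim, ← upperSqrt_sq (TSeq σ τ L w n), sq, Complex.mul_im, theta]
    ring
  have hre : (n : ℝ) ^ (1 / 2 : ℝ) * |(theta σ τ L w n).re| ≤ K :=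
    (mul_le_mul_of_nonneg_left (Complex.abs_re_le_norm _) (by positivity)).trans hn.le
  have habs : 2 * |(theta σ τ L w n).re| * (theta σ τ L w n).im = |w.im| * (n : ℝ) ^ (-σ) := by
    have := congrArg abs hsq
    rwa [abs_mul, abs_mul, abs_mul, abs_two, abs_of_nonneg him,
      abs_of_nonneg (by positivity : 0 ≤ (n : ℝ) ^ (-σ))] at this
  rw [div_div, div_le_iff₀ (by positivity)]
  have e1 : (1 : ℝ) ≤ (n : ℝ) * ((n : ℝ) ^ (1 / 2 : ℝ) * (n : ℝ) ^ (-σ)) := by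
    have e2 := Real.rpow_add hn0 1 (1 / 2 + -σ)
    rw [Real.rpow_one] at e2
    rw [← Real.rpow_add hn0, ← e2]
    exact Real.one_le_rpow hn' (by linarith)
  calc |w.im| ≤ |w.im| * ((n : ℝ) * ((n : ℝ) ^ (1 / 2 : ℝ) * (n : ℝ) ^ (-σ))) :=
        le_mul_of_one_le_right (abs_nonneg _) e1
    _ = (n : ℝ) * (n : ℝ) ^ (1 / 2 : ℝ) * (|w.im| * (n : ℝ) ^ (-σ)) := by ring
    _ = 2 * (n : ℝ) * (theta σ τ L w n).im
          * ((n : ℝ) ^ (1 / 2 : ℝ) * |(theta σ τ L w n).re|) := by rw [← habs]; ring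
    _ ≤ 2 * (n : ℝ) * (theta σ τ L w n).im * K :=
        mul_le_mul_of_nonneg_left hre (by positivity)
    _ = _ := by ring

/-- The leading term of the phases, and the lower bound on their imaginary parts that makes the
Ansatz decay. -/
theorem theta_leading (h : IsRegularPoint σ τ 1 w) :
    Tendsto (fun n : ℕ => (((n : ℝ) ^ (min σ 1 / 2) : ℝ) : ℂ) * theta σ τ L w n) atTop
        (𝓝 (kappa σ τ w)) ∧ kappa σ τ w ≠ 0 ∧
      ∃ c > 0, ∀ᶠ n : ℕ in atTop, c / (n : ℝ) ≤ (theta σ τ L w n).im := by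
  have hσ := h.pos
  rcases h with ⟨h1, h2, ⟨h3, h4⟩ | h3⟩ | ⟨-, h1, h2⟩ | ⟨h1, h2⟩
  · exact theta_leading_of_neg h1 h2 h3 h4
  · have e : tLimit σ τ w = ((-τ : ℝ) : ℂ) := by
      rw [tLimit, min_eq_right h1.le, if_pos (sub_self _), if_neg (by linarith)]
      push_cast; ring
    have hk : kappa σ τ w = upperSqrt (tLimit σ τ w) := by
      rw [kappa, if_pos h1, if_neg h3.not_gt, e, upperSqrt_eq, Complex.norm_real,
        Real.norm_of_nonpos (by linarith), Complex.ofReal_re]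
      simp
    rw [hk]
    refine theta_leading_of_ne hσ fun x hx hx' => ?_
    rw [e] at hx'
    have : -τ = x := by exact_mod_cast hx'
    linarith
  · have e : tLimit σ τ w = w := by
      rw [tLimit, min_eq_left h1.le, if_pos (sub_self _), if_neg (by linarith)]
      ring
    have hk : kappa σ τ w = upperSqrt (tLimit σ τ w) := by
      rw [kappa, if_neg h1.not_gt, if_pos h1, e]
    rw [hk]
    exact theta_leading_of_ne hσ fun x hx => by rw [e]; simpa using h2 x hx
  · subst h1
    have e : tLimit 1 τ w = w - τ := by simp [tLimit]; ring
    have hk : kappa 1 τ w = upperSqrt (tLimit 1 τ w) := by simp [kappa, e]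
    rw [hk]
    refine theta_leading_of_ne hσ fun x hx hx' => ?_
    rw [e] at hx'
    refine h2 (x + τ) (by linarith) ?_
    push_cast
    linear_combination hx'

end Leading

/-! ### The Ansatz as an approximate basis -/

section Ansatz

variable {a b : ℕ → ℝ} {σ τ α β γ : ℝ} {L : ℕ} {z : ℂ}

theorem rho_eq (σ : ℝ) : σ - 2 * rho σ = min σ 1 / 2 := by
  rw [rho]
  split_ifs with h
  · rw [min_eq_right h]; ring
  · rw [min_eq_left (not_le.1 h).le]; ring

theorem IsRegularPoint.one_mul (hγ : γ ^ 2 = 1) (h : IsRegularPoint σ τ γ z) :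
    IsRegularPoint σ τ 1 (γ * z) := by
  have hγ0 : γ ≠ 0 := by rintro rfl; norm_num at hγ
  -- Since `γ ^ 2 = 1`, the conditions `z = γ x` and `γ z = x` are equivalent.
  have key : ∀ x : ℝ, z ≠ ((γ * x : ℝ) : ℂ) → (γ : ℂ) * z ≠ ((1 * x : ℝ) : ℂ) := by
    intro x hx hx'
    refine hx ?_
    have h2 : (γ : ℂ) ^ 2 = 1 := by exact_mod_cast hγ
    push_cast at hx' ⊢
    linear_combination γ * hx' - z * h2
  rcases h with ⟨h1, h2, h3 | h3⟩ | ⟨h0, h1, h2⟩ | ⟨h1, h2⟩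
  · refine Or.inl ⟨h1, h2, Or.inl ⟨h3.1, ?_⟩⟩
    rw [Complex.im_ofReal_mul]
    exact mul_ne_zero hγ0 h3.2
  · exact Or.inl ⟨h1, h2, Or.inr h3⟩
  · exact Or.inr (Or.inl ⟨h0, h1, fun x hx => key x (h2 x hx)⟩)
  · exact Or.inr (Or.inr ⟨h1, fun x hx => key x (h2 x hx)⟩)

/-- The weighted diagonal coefficient `(γ b n - γ z) n ^ (-2 ρ)`. -/
noncomputable def weightedDiag (b : ℕ → ℝ) (σ γ : ℝ) (z : ℂ) (n : ℕ) : ℂ :=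
  γ * ((b n : ℂ) - z) * ((((n : ℝ) ^ (-rho σ) : ℝ) : ℂ)) ^ 2

/-- The terms of order `n ^ (-1)` combine to `2 β / n` because `τ + 2 (α - ρ) - ν = 2 β`, which is
where the value of `τ` and the relation `σ - 2 ρ = ν` enter. -/
theorem weightedDiag_expansion (hγ : γ ^ 2 = 1) (hτ : τ = 2 * β - 2 * α + σ)
    (hb : IsBigOPow (σ - 2) fun n : ℕ => b n - 2 * γ * (n : ℝ) ^ σ * (1 + β * (n : ℝ)⁻¹)) :
    IsBigOPow (-2) fun n : ℕ => (((n : ℝ) ^ (-(min σ 1 / 2)) : ℝ) : ℂ) * weightedDiag b σ γ z n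
      - (2 - tSeq σ τ (γ * z) n
        + (2 * ((α - rho σ : ℝ) : ℂ) - ((min σ 1 / 2 : ℝ) : ℂ)) * (n : ℂ)⁻¹) := by
  have h1 := (((IsBigOPow.rpow (-σ)).mul hb (by linarith : -σ + (σ - 2) ≤ -2)).const_mul γ).ofReal
  refine h1.congr' ?_
  filter_upwards [eventually_gt_atTop 0] with n hn
  have hn' : (0 : ℝ) < n := by exact_mod_cast hn
  have e1 : (((n : ℝ) ^ (-(min σ 1 / 2)) : ℝ) : ℂ) * ((((n : ℝ) ^ (-rho σ) : ℝ) : ℂ)) ^ 2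
      = (((n : ℝ) ^ (-σ) : ℝ) : ℂ) := by
    rw [sq, ← Complex.ofReal_mul, ← Complex.ofReal_mul, ← Real.rpow_add hn', ← Real.rpow_add hn']
    congr 2
    linarith [rho_eq σ]
  have e2 : (((n : ℝ) ^ (-σ) : ℝ) : ℂ) * (((n : ℝ) ^ σ : ℝ) : ℂ) = 1 := by
    rw [← Complex.ofReal_mul, ← Real.rpow_add hn']
    simp
  have e3 : (γ : ℂ) ^ 2 = 1 := by exact_mod_cast hγ
  have e4 : ((min σ 1 / 2 : ℝ) : ℂ) = σ - 2 * rho σ := by rw [← rho_eq]; push_cast; ring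
  rw [e4, weightedDiag, tSeq, hτ]
  push_cast
  linear_combination (-γ * (b n - z)) * e1
    - (γ ^ 2 * 2 * (1 + β * (n : ℂ)⁻¹)) * e2 - 2 * (1 + β * (n : ℂ)⁻¹) * e3

theorem phi_succ (σ τ : ℝ) (L : ℕ) (w : ℂ) (n : ℕ) :
    phi σ τ L w (n + 1) = phi σ τ L w n + theta σ τ L w (n + 1) := by
  rw [phi, phi, Finset.sum_Icc_succ_top (by omega)]

theorem residual_decaying_mul (hγ : γ ^ 2 = 1) (n : ℕ) :
    residual a b z (decayingAnsatz σ τ γ L z) n * growingAnsatz σ τ γ L z (n + 1)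
      = phaseResidual (weightedCoeff a (rho σ)) (weightedDiag b σ γ z)
          (theta σ τ L (γ * z)) (n + 1) := by
  have e1 : (γ : ℂ) ^ 2 = 1 := by exact_mod_cast hγ
  have e2 : (-(γ : ℂ)) ^ n * (-(γ : ℂ)) ^ n = 1 := by
    rw [← pow_add, ← two_mul, pow_mul, neg_sq, e1, one_pow]
  simp only [residual, decayingAnsatz, growingAnsatz, phaseResidual, weightedCoeff, weightedDiag,
    phi_succ, mul_add, neg_add, Complex.exp_add, Nat.add_sub_cancel]
  have e3 : Complex.exp (Complex.I * phi σ τ L (γ * z) n)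
      * Complex.exp (-(Complex.I * phi σ τ L (γ * z) n)) = 1 := by
    rw [← Complex.exp_add, add_neg_cancel, Complex.exp_zero]
  have e4 : Complex.exp (Complex.I * theta σ τ L (γ * z) (n + 1))
      * Complex.exp (-(Complex.I * theta σ τ L (γ * z) (n + 1))) = 1 := by
    rw [← Complex.exp_add, add_neg_cancel, Complex.exp_zero]
  generalize Complex.exp (Complex.I * phi σ τ L (γ * z) n) = E at *
  generalize Complex.exp (-(Complex.I * phi σ τ L (γ * z) n)) = E' at *
  generalize Complex.exp (Complex.I * theta σ τ L (γ * z) (n + 1)) = A at *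
  generalize Complex.exp (-(Complex.I * theta σ τ L (γ * z) (n + 1))) = A' at *
  generalize Complex.exp (Complex.I * theta σ τ L (γ * z) (n + 1 + 1)) = B at *
  push_cast
  rw [show (n : ℝ) + 2 = n + 1 + 1 by ring]
  simp only [pow_succ (-(γ : ℂ))]
  generalize (-(γ : ℂ)) ^ n = c at *
  generalize (((n : ℝ) ^ (-rho σ) : ℝ) : ℂ) = p
  generalize ((((n : ℝ) + 1) ^ (-rho σ) : ℝ) : ℂ) = p1
  generalize ((((n : ℝ) + 1 + 1) ^ (-rho σ) : ℝ) : ℂ) = p2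
  -- The relations for the sign, the two pairs of exponentials and `γ` are eliminated in turn.
  linear_combination
    (a n * p * p1 * γ ^ 2 * (E * E') * A' - (b (n + 1) - z) * p1 ^ 2 * γ ^ 3 * (E * E') * (A * A')
      + a (n + 1) * p1 * p2 * γ ^ 4 * (E * E') * (A * A') * B) * e2
    + (a n * p * p1 * γ ^ 2 * A' - (b (n + 1) - z) * p1 ^ 2 * γ ^ 3 * (A * A')
      + a (n + 1) * p1 * p2 * γ ^ 4 * (A * A') * B) * e3
    + (-(b (n + 1) - z) * p1 ^ 2 * γ ^ 3 + a (n + 1) * p1 * p2 * γ ^ 4 * B) * e4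
    + (a n * p * p1 * A' - (b (n + 1) - z) * p1 ^ 2 * γ
      + a (n + 1) * p1 * p2 * B * (γ ^ 2 + 1)) * e1

theorem residual_growing_mul (hγ : γ ^ 2 = 1) (n : ℕ) :
    residual a b z (growingAnsatz σ τ γ L z) n * decayingAnsatz σ τ γ L z (n + 1)
      = phaseResidual (weightedCoeff a (rho σ)) (weightedDiag b σ γ z)
          (fun m => -theta σ τ L (γ * z) m) (n + 1) := by
  have e1 : (γ : ℂ) ^ 2 = 1 := by exact_mod_cast hγ
  have e2 : (-(γ : ℂ)) ^ n * (-(γ : ℂ)) ^ n = 1 := by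
    rw [← pow_add, ← two_mul, pow_mul, neg_sq, e1, one_pow]
  simp only [residual, decayingAnsatz, growingAnsatz, phaseResidual, weightedCoeff, weightedDiag,
    phi_succ, mul_add, neg_add, Complex.exp_add, Nat.add_sub_cancel, mul_neg, neg_neg]
  have e3 : Complex.exp (Complex.I * phi σ τ L (γ * z) n)
      * Complex.exp (-(Complex.I * phi σ τ L (γ * z) n)) = 1 := by
    rw [← Complex.exp_add, add_neg_cancel, Complex.exp_zero]
  have e4 : Complex.exp (Complex.I * theta σ τ L (γ * z) (n + 1))
      * Complex.exp (-(Complex.I * theta σ τ L (γ * z) (n + 1))) = 1 := by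
    rw [← Complex.exp_add, add_neg_cancel, Complex.exp_zero]
  generalize Complex.exp (Complex.I * phi σ τ L (γ * z) n) = E at *
  generalize Complex.exp (-(Complex.I * phi σ τ L (γ * z) n)) = E' at *
  generalize Complex.exp (Complex.I * theta σ τ L (γ * z) (n + 1)) = A at *
  generalize Complex.exp (-(Complex.I * theta σ τ L (γ * z) (n + 1))) = A' at *
  generalize Complex.exp (-(Complex.I * theta σ τ L (γ * z) (n + 1 + 1))) = B at *
  push_cast
  rw [show (n : ℝ) + 2 = n + 1 + 1 by ring]
  simp only [pow_succ (-(γ : ℂ))]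
  generalize (-(γ : ℂ)) ^ n = c at *
  generalize (((n : ℝ) ^ (-rho σ) : ℝ) : ℂ) = p
  generalize ((((n : ℝ) + 1) ^ (-rho σ) : ℝ) : ℂ) = p1
  generalize ((((n : ℝ) + 1 + 1) ^ (-rho σ) : ℝ) : ℂ) = p2
  -- The relations for the sign, the two pairs of exponentials and `γ` are eliminated in turn.
  linear_combination
    (a n * p * p1 * γ ^ 2 * (E * E') * A - (b (n + 1) - z) * p1 ^ 2 * γ ^ 3 * (E * E') * (A * A')
      + a (n + 1) * p1 * p2 * γ ^ 4 * (E * E') * (A * A') * B) * e2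
    + (a n * p * p1 * γ ^ 2 * A - (b (n + 1) - z) * p1 ^ 2 * γ ^ 3 * (A * A')
      + a (n + 1) * p1 * p2 * γ ^ 4 * (A * A') * B) * e3
    + (-(b (n + 1) - z) * p1 ^ 2 * γ ^ 3 + a (n + 1) * p1 * p2 * γ ^ 4 * B) * e4
    + (a n * p * p1 * A - (b (n + 1) - z) * p1 ^ 2 * γ
      + a (n + 1) * p1 * p2 * B * (γ ^ 2 + 1)) * e1

theorem casoratian_ansatz (hγ : γ ^ 2 = 1) (n : ℕ) :
    casoratian a (growingAnsatz σ τ γ L z) (decayingAnsatz σ τ γ L z) n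
      = weightedCoeff a (rho σ) n * (Complex.exp (Complex.I * theta σ τ L (γ * z) (n + 1))
        - Complex.exp (-(Complex.I * theta σ τ L (γ * z) (n + 1)))) := by
  have e1 : (γ : ℂ) ^ 2 = 1 := by exact_mod_cast hγ
  have e2 : (-(γ : ℂ)) ^ n * (-(γ : ℂ)) ^ n = 1 := by
    rw [← pow_add, ← two_mul, pow_mul, neg_sq, e1, one_pow]
  simp only [casoratian, decayingAnsatz, growingAnsatz, weightedCoeff,
    phi_succ, mul_add, neg_add, Complex.exp_add]
  have e3 : Complex.exp (Complex.I * phi σ τ L (γ * z) n)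
      * Complex.exp (-(Complex.I * phi σ τ L (γ * z) n)) = 1 := by
    rw [← Complex.exp_add, add_neg_cancel, Complex.exp_zero]
  generalize Complex.exp (Complex.I * phi σ τ L (γ * z) n) = E at *
  generalize Complex.exp (-(Complex.I * phi σ τ L (γ * z) n)) = E' at *
  generalize Complex.exp (Complex.I * theta σ τ L (γ * z) (n + 1)) = A at *
  generalize Complex.exp (-(Complex.I * theta σ τ L (γ * z) (n + 1))) = A' at *
  push_cast
  simp only [pow_succ (-(γ : ℂ))]
  generalize (-(γ : ℂ)) ^ n = c at *
  generalize (((n : ℝ) ^ (-rho σ) : ℝ) : ℂ) = p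
  generalize ((((n : ℝ) + 1) ^ (-rho σ) : ℝ) : ℂ) = p1
  linear_combination a n * p * p1 * (A - A') * (γ ^ 2 * (E * E') * e2 + γ ^ 2 * e3 + e1)

/-- The size of the quotient of the two Ansätze. -/
noncomputable def ansatzRatio (σ τ : ℝ) (L : ℕ) (w : ℂ) (n : ℕ) : ℝ :=
  Real.exp (-(2 * (phi σ τ L w n).im))

theorem norm_decayingAnsatz (hγ : |γ| = 1) (n : ℕ) :
    ‖decayingAnsatz σ τ γ L z n‖
      = ansatzRatio σ τ L (γ * z) n * ‖growingAnsatz σ τ γ L z n‖ := by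
  have h1 : ‖(-(γ : ℂ))‖ = 1 := by simpa using hγ
  rw [decayingAnsatz, growingAnsatz, ansatzRatio]
  simp only [norm_mul, norm_pow, h1, one_pow, one_mul, Complex.norm_exp]
  rw [mul_left_comm, ← Real.exp_add]
  congr 2
  simp
  ring

theorem ansatzRatio_succ (σ τ : ℝ) (L : ℕ) (w : ℂ) (n : ℕ) :
    ansatzRatio σ τ L w (n + 1)
      = ansatzRatio σ τ L w n * Real.exp (-(2 * (theta σ τ L w (n + 1)).im)) := by
  rw [ansatzRatio, ansatzRatio, ← Real.exp_add, phi_succ, Complex.add_im]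
  ring_nf

theorem ansatzRatio_antitone (σ τ : ℝ) (L : ℕ) (w : ℂ) : Antitone (ansatzRatio σ τ L w) := by
  refine antitone_nat_of_succ_le fun n => ?_
  rw [ansatzRatio_succ]
  refine mul_le_of_le_one_right (Real.exp_pos _).le (Real.exp_le_one_iff.2 ?_)
  linarith [theta_im_nonneg (σ := σ) (τ := τ) (L := L) (w := w) (n + 1)]

/-- The Ansatz decays since the harmonic series diverges. -/
theorem tendsto_ansatzRatio {w : ℂ} {c : ℝ} (hc : 0 < c)
    (h : ∀ᶠ n : ℕ in atTop, c / (n : ℝ) ≤ (theta σ τ L w n).im) :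
    Tendsto (ansatzRatio σ τ L w) atTop (𝓝 0) := by
  have hns : ¬ Summable fun n => (theta σ τ L w (n + 1)).im := by
    rw [summable_nat_add_iff (f := fun n => (theta σ τ L w n).im) 1]
    intro hs
    refine Real.not_summable_one_div_natCast (summable_of_isBigO_nat hs
      (IsBigO.of_bound c⁻¹ ?_))
    filter_upwards [h] with n hn
    rw [Real.norm_of_nonneg (by positivity), Real.norm_of_nonneg (theta_im_nonneg n)]
    calc 1 / (n : ℝ) = c⁻¹ * (c / n) := by field_simp
      _ ≤ _ := mul_le_mul_of_nonneg_left hn (by positivity)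
  have ht := (not_summable_iff_tendsto_nat_atTop_of_nonneg
    (fun n => theta_im_nonneg (n + 1))).1 hns
  have hphi : ∀ n, (phi σ τ L w n).im = ∑ i ∈ Finset.range n, (theta σ τ L w (i + 1)).im := by
    intro n
    induction n with
    | zero => simp [phi]
    | succ n ih => rw [phi_succ, Complex.add_im, Finset.sum_range_succ, ih]
  refine Real.tendsto_exp_neg_atTop_nhds_zero.comp (Tendsto.const_mul_atTop two_pos ?_)
  exact ht.congr fun n => (hphi n).symm

theorem IsPhase.eventually_ansatzRatio_le {ν ε : ℝ} {κ w : ℂ} {t : ℕ → ℂ}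
    (h : IsPhase ν ε κ t (theta σ τ L w)) :
    ∀ᶠ n in atTop, ansatzRatio σ τ L w n ≤ 2 * ansatzRatio σ τ L w (n + 1) := by
  have h1 : Tendsto (fun n => 2 * Real.exp (-(2 * (theta σ τ L w (n + 1)).im))) atTop (𝓝 2) := by
    have h2 := (h.isBigOPow.tendsto_zero (by linarith [h.ν_pos])).comp (tendsto_add_atTop_nat 1)
    have hcont : Continuous fun x : ℂ => 2 * Real.exp (-(2 * x.im)) := by fun_prop
    simpa [Function.comp_def] using (hcont.tendsto 0).comp h2
  filter_upwards [h1.eventually_const_lt one_lt_two] with n hn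
  rw [ansatzRatio_succ, mul_left_comm]
  exact le_mul_of_one_le_right (Real.exp_pos _).le hn.le

theorem IsPhase.tendsto_casoratian {ν ε c : ℝ} {κ : ℂ} {t θ : ℕ → ℂ} (h : IsPhase ν ε κ t θ)
    {x : ℕ → ℝ}
    (hx : IsBigOPow (ν - 2) fun n : ℕ => x n - (n : ℝ) ^ ν - c * (n : ℝ) ^ (ν - 1)) :
    Tendsto (fun n => (x n : ℂ) * (Complex.exp (Complex.I * θ (n + 1))
      - Complex.exp (-(Complex.I * θ (n + 1))))) atTop (𝓝 (2 * Complex.I * κ)) := by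
  have hν := h.ν_pos
  have hν' := h.ν_le
  have hxν : IsBigOPow (ν - 1) fun n : ℕ => x n - (n : ℝ) ^ ν :=
    ((hx.mono (by linarith)).add ((IsBigOPow.rpow (ν - 1)).const_mul c)).congr fun n => by ring
  have hx0 : IsBigOPow ν x :=
    ((hxν.mono (by linarith)).add (IsBigOPow.rpow ν)).congr fun n => by ring
  have hθ := h.isBigOPow.comp_succ
  have h1 := (h.tendsto.comp (tendsto_add_atTop_nat 1)).const_mul (2 * Complex.I)
  have h2 := ((hxν.sub (isBigOPow_succ_rpow_sub ν)).ofReal.mul (hθ.const_mul (2 * Complex.I))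
    (by linarith : ν - 1 + -ν ≤ -1)).tendsto_zero (by norm_num)
  have hI : IsBigOPow (-ν) fun n => Complex.I * θ (n + 1) := hθ.const_mul _
  have hI' : IsBigOPow (-ν) fun n => -(Complex.I * θ (n + 1)) :=
    (hI.const_mul (-1)).congr fun n => by ring
  have h3 := (hx0.ofReal.mul ((hI.exp_sub (by linarith)).sub (hI'.exp_sub (by linarith)))
    (by linarith : ν + 2 * -ν ≤ -ν)).tendsto_zero (by linarith)
  have h4 := (h1.add h2).add h3
  rw [add_zero, add_zero] at h4
  refine h4.congr fun n => ?_
  simp only [Function.comp]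
  push_cast
  ring

/-- Under the assumptions of the theorem the two Ansätze are approximate solutions of the Jacobi
equation. -/
theorem approxBasis_ansatz (ha : ∀ n, 0 < a n) (hγ : |γ| = 1) (hτ : τ = 2 * β - 2 * α + σ)
    (hasa : IsBigOPow (σ - 2) fun n : ℕ => a n - (n : ℝ) ^ σ * (1 + α * (n : ℝ)⁻¹))
    (hasb : IsBigOPow (σ - 2) fun n : ℕ => b n - 2 * γ * (n : ℝ) ^ σ * (1 + β * (n : ℝ)⁻¹))
    (hz : IsRegularPoint σ τ γ z) (hL : σ < 1 → 1 < ((L : ℝ) + 1 / 2) * σ) :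
    ApproxBasis a b z (decayingAnsatz σ τ γ L z) (growingAnsatz σ τ γ L z)
      (ansatzRatio σ τ L (γ * z)) (2 * Complex.I * kappa σ τ (γ * z)) := by
  have hγ2 : γ ^ 2 = 1 := by rw [← sq_abs, hγ, one_pow]
  obtain ⟨hlim, hκ, c, hc, him⟩ := theta_leading (L := L) (hz.one_mul hγ2)
  obtain ⟨ε, hph⟩ := exists_isPhase hz.pos hL hκ hlim
  have hx := weightedCoeff_expansion (rho_eq σ) hasa
  have hy := weightedDiag_expansion (z := z) hγ2 hτ hasb
  have hε := hph.ε_pos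
  refine ⟨ha, fun n => Real.exp_pos _, ansatzRatio_antitone _ _ _ _,
    hph.eventually_ansatzRatio_le, tendsto_ansatzRatio hc him, norm_decayingAnsatz hγ,
    mul_ne_zero (mul_ne_zero two_ne_zero Complex.I_ne_zero) hκ,
    (hph.tendsto_casoratian hx).congr fun n => (casoratian_ansatz hγ2 n).symm, ?_, ?_, ?_⟩
  · filter_upwards [eventually_gt_atTop 0] with n hn
    have hn' : (0 : ℝ) < n := by exact_mod_cast hn
    have hγ0 : (γ : ℂ) ≠ 0 := by rintro h; simp_all
    refine mul_ne_zero (mul_ne_zero (pow_ne_zero _ (neg_ne_zero.2 hγ0)) ?_) (Complex.exp_ne_zero _)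
    exact_mod_cast (Real.rpow_pos_of_pos hn' _).ne'
  · have h1 := ((hph.phaseResidual hx hy).comp_succ).norm_summable (by linarith)
    simpa only [← residual_decaying_mul hγ2, norm_mul] using h1
  · have h1 := ((hph.neg.phaseResidual hx hy).comp_succ).norm_summable (by linarith)
    simpa only [← residual_growing_mul hγ2, norm_mul] using h1

end Ansatz

/-- The two forms of the asymptotics of a solution both follow from `F = (W κ⁻¹ + o(1)) M`. -/
theorem hasRegularAsymptotics_of_isLittleO {a : ℕ → ℝ} {σ τ γ : ℝ} {L : ℕ} {z : ℂ} {f F : ℕ → ℂ}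
    (hκ : kappa σ τ (γ * z) ≠ 0)
    (h : (fun n => F n - wronskian a F f * (2 * Complex.I * kappa σ τ (γ * z))⁻¹
      * growingAnsatz σ τ γ L z n) =o[atTop] growingAnsatz σ τ γ L z) :
    HasRegularAsymptotics a σ τ γ L z f F := by
  have e : wronskian a F f * (2 * Complex.I * kappa σ τ (γ * z))⁻¹
      = -Complex.I * wronskian a F f * (2 * kappa σ τ (γ * z))⁻¹ := by
    rw [mul_inv, mul_inv, mul_inv, Complex.inv_I]
    ring
  rw [e] at h
  refine ⟨h, fun hW => ?_⟩
  refine (isLittleO_const_mul_right_iff ?_).2 h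
  exact mul_ne_zero (mul_ne_zero (neg_ne_zero.2 Complex.I_ne_zero) hW)
    (inv_ne_zero (mul_ne_zero two_ne_zero hκ))

end CriticalJacobi

theorem theorem6p6 (a b : ℕ → ℝ) (α β γ σ τ : ℝ) (z : ℂ) (L : ℕ)
    (ha : ∀ n, 0 < a n) (hγ : |γ| = 1) (hτ : τ = 2 * β - 2 * α + σ)
    (hasa : (fun n : ℕ => a n - (n : ℝ) ^ σ * (1 + α * (n : ℝ)⁻¹))
      =O[atTop] fun n : ℕ => (n : ℝ) ^ (σ - 2))
    (hasb : (fun n : ℕ => b n - 2 * γ * (n : ℝ) ^ σ * (1 + β * (n : ℝ)⁻¹))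
      =O[atTop] fun n : ℕ => (n : ℝ) ^ (σ - 2))
    (hz : CriticalJacobi.IsRegularPoint σ τ γ z)
    (hL : σ < 1 → 1 < ((L : ℝ) + 1 / 2) * σ) :
    ∃ f : ℕ → ℂ, CriticalJacobi.IsJostSolution a b σ τ γ L z f ∧
      (∀ f' : ℕ → ℂ, CriticalJacobi.IsJostSolution a b σ τ γ L z f' → f' = f) ∧
      (∀ F : ℕ → ℂ, CriticalJacobi.IsSolution a b z F →
        CriticalJacobi.HasRegularAsymptotics a σ τ γ L z f F) ∧
      CriticalJacobi.HasRegularAsymptotics a σ τ γ L z f (CriticalJacobi.orthoPoly a b z) := by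
  have h := CriticalJacobi.approxBasis_ansatz ha hγ hτ hasa hasb hz hL
  have hκ := right_ne_zero_of_mul h.ne_zero
  obtain ⟨f, hf, hα, hβ⟩ := h.exists_recessive
  have hJ := h.isEquivalent_of_recessive hα hβ
  have hreg : ∀ F : ℕ → ℂ, CriticalJacobi.IsSolution a b z F →
      CriticalJacobi.HasRegularAsymptotics a σ τ γ L z f F := fun F hF =>
    CriticalJacobi.hasRegularAsymptotics_of_isLittleO hκ (h.isLittleO_sub hf hα hβ hF)
  refine ⟨f, ⟨hf, hJ⟩, fun f' hf' => ?_, hreg, hreg _ (CriticalJacobi.orthoPoly_isSolution ha b z)⟩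
  have hd := h.eq_zero_of_isLittleO (hf'.1.linear_comb hf 1 (-1))
    ((hf'.2.isLittleO.sub hJ.isLittleO).congr_left fun n => by simp; ring)
  funext n
  have := congrFun hd n
  simp only [Pi.zero_apply] at this
  linear_combination this
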